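/- Theorem 1 (Stability with Spectral Truncation). Let $\epsilon>0$, $\lambda\in\mathbb{R}$ and $c>0$ with $c+\lambda\ge 0$, and put $\lambda_0=\frac{\lambda+c}{\epsilon}$, $N_0=\sqrt{\frac{c+\lambda}{4\pi^2\epsilon}}$. Let $I_1$ be the modified Bessel function of the first kind of order $1$, let $\operatorname{sinc}(z)=\frac{\sin z}{z}$ (with $\operatorname{sinc}(0)=1$), and let $$h(\eta)=\lambda_0\,\eta\,\frac{I_1\!\left(\sqrt{\lambda_0(1-\eta^2)}\right)}{\sqrt{\lambda_0(1-\eta^2)}},\qquad K_{1,N}(x,\xi,\eta)=2N\,h(\eta)\,\operatorname{sinc}(2\pi N(x-\xi))$$ (with $I_1(z)/z$ read as $\tfrac12$ at $z=0$). For $N\in\mathbb{N}$ consider on the strip $\mathbb{R}\times[0,1]$ the closed-loop system $$u_t=\epsilon(u_{xx}+u_{yy})+\lambda u,\qquad u(t,x,0)=0,\qquad u(t,x,1)=U_N(t,x),$$ $$U_N(t,x)=-\int_0^1\int_{-\infty}^{\infty}K_{1,N}(x,\xi,\eta)\,u(t,\xi,\eta)\,d\xi\,d\eta .$$ A solution is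 a real-valued $u\in C([0,\infty);L^2(\mathbb{R}\times[0,1]))$ that satisfies these equations weakly, that is, $$\int u(t)\varphi\,dx\,dy=\int u(0)\varphi\,dx\,dy+\int_0^t\Big(\int u(s)\big[\epsilon(\varphi_{xx}+\varphi_{yy})+\lambda\varphi\big]dx\,dy-\epsilon\int_{\mathbb{R}}U_N(s,x)\,\varphi_y(x,1)\,dx\Big)ds$$ for all $t\ge0$ and all $\varphi\in C_c^\infty(\mathbb{R}^2)$ with $\varphi(x,0)=\varphi(x,1)=0$ for all $x$, the integrals in $dx\,dy$ being over $\mathbb{R}\times[0,1]$. Then there is a constant $M\ge 1$, depending only on $\epsilon,\lambda,c$ and in particular not on $N$, such that for every $N\in\mathbb{N}$ with $N\ge N_0$, every solution $u$ and every $t\ge 0$, $$\Vert u(t,\cdot,\cdot)\Vert_{L^2(\mathbb{R}\times[0,1])}\le M e^{-ct}\,\Vert u(0,\cdot,\cdot)\Vert_{L^2(\mathbb{R}\times[0,1])} .$$ -/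

import Mathlib

open MeasureTheory Set
open scoped ContDiff

noncomputable section

namespace StripControl

/-- The modified Bessel function of the first kind `I_n`, of integer order `n ≥ 0`, at a real
argument. -/
def besselI (n : ℕ) (z : ℝ) : ℝ :=
  ∑' m : ℕ, (z / 2) ^ (2 * m + n) / ((m.factorial : ℝ) * ((m + n).factorial : ℝ))

/-- The function `I_1(z) / z`, with its removable singularity at `z = 0` filled in by the limit
value `1 / 2`. -/
def besselQuot (z : ℝ) : ℝ :=
  if z = 0 then 1 / 2 else besselI 1 z / z

/-- The coefficient `λ₀ = (λ + c) / ε`. -/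
def lambda0 (ε lam c : ℝ) : ℝ := (lam + c) / ε

/-- The backstepping gain
`h(η) = λ₀ η I_1(√(λ₀ (1 - η²))) / √(λ₀ (1 - η²))`. -/
def gain (ε lam c η : ℝ) : ℝ :=
  lambda0 ε lam c * η * besselQuot (Real.sqrt (lambda0 ε lam c * (1 - η ^ 2)))

/-- The truncated kernel `K_{1,N}(x, ξ, η) = 2 N h(η) sinc(2 π N (x - ξ))`, where
`sinc z = sin z / z` and `sinc 0 = 1`. -/
def truncatedKernel (ε lam c : ℝ) (N : ℕ) (x ξ η : ℝ) : ℝ :=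
  2 * (N : ℝ) * gain ε lam c η * Real.sinc (2 * Real.pi * (N : ℝ) * (x - ξ))

/-- Lebesgue measure on the strip `ℝ × [0, 1]`, points being written `(x, y)`. -/
abbrev stripMeasure : Measure (ℝ × ℝ) :=
  (volume : Measure ℝ).prod ((volume : Measure ℝ).restrict (Icc (0 : ℝ) 1))

/-- The real Hilbert space `L²(ℝ × [0, 1])`. -/
abbrev StripL2 : Type := Lp ℝ 2 stripMeasure

/-- The truncated feedback law
`U_N(x) = - ∫_0^1 ∫_ℝ K_{1,N}(x, ξ, η) v(ξ, η) dξ dη` for the state `v`. -/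
def truncatedFeedback (ε lam c : ℝ) (N : ℕ) (v : StripL2) (x : ℝ) : ℝ :=
  -∫ η in (0 : ℝ)..1, ∫ ξ : ℝ, truncatedKernel ε lam c N x ξ η * v (ξ, η)

/-- Test functions: smooth and compactly supported functions of `(x, y)` that vanish on the two
boundary lines `y = 0` and `y = 1` of the strip. The support may touch these lines, and the normal
derivative there is unrestricted. -/
structure IsTestFunction (φ : ℝ × ℝ → ℝ) : Prop where
  smooth : ContDiff ℝ ∞ φ
  compactSupport : HasCompactSupport φ
  bottom : ∀ x : ℝ, φ (x, 0) = 0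
  top : ∀ x : ℝ, φ (x, 1) = 0

/-- The differential operator `ε (∂_xx + ∂_yy) φ + λ φ`. -/
def reactionDiffusion (ε lam : ℝ) (φ : ℝ × ℝ → ℝ) (p : ℝ × ℝ) : ℝ :=
  ε * (iteratedDeriv 2 (fun x : ℝ => φ (x, p.2)) p.1
      + iteratedDeriv 2 (fun y : ℝ => φ (p.1, y)) p.2) + lam * φ p

/-- `u ∈ C([0, ∞); L²(ℝ × [0, 1]))` is a weak solution (in the sense of transposition) of
`u_t = ε (u_xx + u_yy) + λ u` on the strip, `u = 0` at `y = 0` and `u(t, x, 1) = U_N(t, x)`,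
where `U_N` is the truncated feedback of the current state. The weak form comes from multiplying
by a test function and integrating by parts in space; the only boundary term that is left is
`- ε ∫ u(t, x, 1) φ_y(x, 1) dx`, because `φ` vanishes on both lines and `u` vanishes at
`y = 0`. Values of `u` at negative times play no role. -/
structure IsClosedLoopSolution (ε lam c : ℝ) (N : ℕ) (u : ℝ → StripL2) : Prop where
  continuous : ContinuousOn u (Ici (0 : ℝ))
  weak : ∀ φ : ℝ × ℝ → ℝ, IsTestFunction φ → ∀ t : ℝ, 0 ≤ t →
    ∫ p, u t p * φ p ∂stripMeasure
      = ∫ p, u 0 p * φ p ∂stripMeasure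
        + ∫ s in (0 : ℝ)..t,
            ((∫ p, u s p * reactionDiffusion ε lam φ p ∂stripMeasure)
              - ε * ∫ x : ℝ, truncatedFeedback ε lam c N (u s) x
                  * deriv (fun y : ℝ => φ (x, y)) 1)

end StripControl

end

/-! The system is invariant under translations in x, so it splits over the longitudinal frequency k,
and the truncated kernel is in x the convolution kernel of the sharp filter to |k| ≤ N. For |k| > N
the feedback is invisible: the Dirichlet modes in y have growth rates λ - ε((n+1)π)² - 4π²εk², which
lie below -c because N ≥ N₀ forces 4π²εk² ≥ c + λ. For |k| < N the feedback is the full backstepping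
law: with k(y,η) = `backKernel`, whose trace at y = 1 is h, the Volterra map w = u + ∫_0^y k(y,η)
u(η) dη turns the closed loop into w_t = ε(w_xx + w_yy) - c w with Dirichlet conditions. This map
and its inverse are bounded in terms of λ₀ only, and frequencies do not mix, so the overshoot does
not depend on N.

A weak solution has no derivatives to which the map could be applied, so the argument is dual. Let
s_n be the sine modes and b_n(η) = s_n(η) + ∫_η^1 k(y,η) s_n(y) dy their adjoint transforms
(`backMode`). The kernel satisfies k_ηη = k_yy - λ₀ k, k(y,y) = λ₀y/2 and k(y,0) = 0. Hence b_n
vanishes at 0 and 1, and ε b_n'' + λ b_n + ε b_n'(1) h = -(c + ε((n+1)π)²) b_n on [0,1]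
(`transversal_backMode`). Testing with products a(x)ψ(y), where ψ = b_n for spectra of a inside the
band and ψ = s_n outside, therefore gives a closed equation at each frequency.
`IsClosedLoopSolution.norm_mulOp_le` turns it into decay at rate c of each mode localized in
frequency.

For the assembly, Parseval in y recovers the L² norm from the sine coefficients. The coefficients
against b_n are the sine coefficients of the transformed function, so both families have comparable
square sums, with a constant C depending only on λ₀ (`exists_backMode_bounds`). The low band costs
C² and the high band costs 1, whence M = √(C² + 1). Smooth cutoffs keep the test functions Schwartz,
and Fatou's lemma removes them at the end (`tsum_enorm_sq_le_of_cutoff`). -/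

noncomputable section

namespace StripControl

open Filter Topology
open scoped ENNReal NNReal RealInnerProductSpace SchwartzMap FourierTransform

/-! ### Bessel–Clifford functions and the backstepping kernel -/

/-- The Bessel–Clifford function `C_j(z) = ∑ z^m / (m! (m+j)!)`. -/
def besselClifford (j : ℕ) (z : ℝ) : ℝ :=
  ∑' m : ℕ, z ^ m / ((m.factorial : ℝ) * ((m + j).factorial : ℝ))

lemma norm_besselClifford_term_le (j m : ℕ) (z : ℝ) :
    ‖z ^ m / ((m.factorial : ℝ) * ((m + j).factorial : ℝ))‖ ≤ |z| ^ m / (m.factorial : ℝ) := by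
  have h1 : (1 : ℝ) ≤ ((m + j).factorial : ℝ) := by
    exact_mod_cast Nat.one_le_iff_ne_zero.mpr (Nat.factorial_ne_zero _)
  have h2 : (0 : ℝ) < (m.factorial : ℝ) := by exact_mod_cast Nat.factorial_pos m
  rw [norm_div, norm_pow, Real.norm_eq_abs, Real.norm_of_nonneg (by positivity)]
  gcongr
  nlinarith

lemma summable_besselClifford (j : ℕ) (z : ℝ) :
    Summable fun m : ℕ => z ^ m / ((m.factorial : ℝ) * ((m + j).factorial : ℝ)) :=
  .of_norm_bounded (Real.summable_pow_div_factorial |z|)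
    fun m => norm_besselClifford_term_le j m z

/-- Termwise differentiation: the m = 0 term drops out, and shifting the index gives a series of the
same family. All derivatives of the kernel are thereby explicit. -/
lemma hasDerivAt_besselClifford (j : ℕ) (z : ℝ) :
    HasDerivAt (besselClifford j) (besselClifford (j + 1) z) z := by
  have key : ∀ (m : ℕ) (y : ℝ), ((m + 1 : ℕ) : ℝ) * y ^ m /
      (((m + 1).factorial : ℝ) * ((m + 1 + j).factorial : ℝ))
        = y ^ m / ((m.factorial : ℝ) * ((m + (j + 1)).factorial : ℝ)) := by
    intro m y
    have h2 : (m.factorial : ℝ) ≠ 0 := by exact_mod_cast Nat.factorial_ne_zero m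
    have h3 : ((m + 1 + j).factorial : ℝ) ≠ 0 := by exact_mod_cast Nat.factorial_ne_zero _
    have h4 : ((m : ℝ) + 1) ≠ 0 := by positivity
    rw [show m + (j + 1) = m + 1 + j by ring, Nat.factorial_succ]
    push_cast
    field_simp
  set R : ℝ := |z| + 1
  have hR : 0 ≤ R := by positivity
  have h := hasDerivAt_tsum_of_isPreconnected
    (g := fun (m : ℕ) (y : ℝ) => y ^ m / ((m.factorial : ℝ) * ((m + j).factorial : ℝ)))
    (g' := fun (m : ℕ) (y : ℝ) => (m : ℝ) * y ^ (m - 1) /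
      ((m.factorial : ℝ) * ((m + j).factorial : ℝ)))
    (u := fun m : ℕ => (m : ℝ) * R ^ (m - 1) /
      ((m.factorial : ℝ) * ((m + j).factorial : ℝ)))
    (t := Metric.ball 0 R) (y₀ := 0) (y := z) ?_ Metric.isOpen_ball
    (convex_ball (0 : ℝ) R).isPreconnected ?_ ?_ ?_ (summable_besselClifford j 0) ?_
  · convert! h using 1
    rw [(hasSum_nat_add_iff' 1).mp ?_ |>.tsum_eq]
    simp only [Finset.range_one, Finset.sum_singleton, Nat.cast_zero, zero_mul, zero_div, sub_zero,
      Nat.add_sub_cancel, key]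
    exact (summable_besselClifford (j + 1) z).hasSum
  · rw [← summable_nat_add_iff 1]
    simp only [Nat.add_sub_cancel, key]
    exact summable_besselClifford (j + 1) R
  · intro m y _
    exact (hasDerivAt_pow m y).div_const _
  · intro m y hy
    rw [Metric.mem_ball, dist_zero_right, Real.norm_eq_abs] at hy
    rw [norm_div, norm_mul, norm_pow, Real.norm_eq_abs, Real.norm_eq_abs,
      Real.norm_of_nonneg (by positivity), Nat.abs_cast]
    gcongr
  · simp [R]; positivity
  · simp [R]

/-- Coefficientwise this is m + (j + 1) = m + j + 1. Combined with C_j' = C_{j+1} it is Bessel's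
equation; the case j = 1 yields the wave equation of the kernel. -/
lemma besselClifford_recurrence (j : ℕ) (z : ℝ) :
    z * besselClifford (j + 2) z + (j + 1) * besselClifford (j + 1) z = besselClifford j z := by
  have h0 : HasSum (fun m : ℕ => (m : ℝ) * z ^ m /
      ((m.factorial : ℝ) * ((m + (j + 1)).factorial : ℝ))) (z * besselClifford (j + 2) z) := by
    rw [← hasSum_nat_add_iff' 1]
    simp only [Finset.range_one, Finset.sum_singleton, Nat.cast_zero, zero_mul, zero_div, sub_zero]
    refine ((summable_besselClifford (j + 2) z).hasSum.mul_left z).congr_fun ?_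
    intro m
    have h2 : (m.factorial : ℝ) ≠ 0 := by exact_mod_cast Nat.factorial_ne_zero m
    have h4 : ((m : ℝ) + 1) ≠ 0 := by positivity
    have h3 : ((m + 1 + (j + 1)).factorial : ℝ) ≠ 0 := by exact_mod_cast Nat.factorial_ne_zero _
    rw [show m + (j + 2) = m + 1 + (j + 1) by ring, Nat.factorial_succ m]
    push_cast
    field_simp
    try ring
  have h1 := h0.add ((summable_besselClifford (j + 1) z).hasSum.mul_left ((j : ℝ) + 1))
  refine h1.unique ((summable_besselClifford j z).hasSum.congr_fun ?_)
  intro m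
  have h2 : (m.factorial : ℝ) ≠ 0 := by exact_mod_cast Nat.factorial_ne_zero m
  have h3 : ((m + j).factorial : ℝ) ≠ 0 := by exact_mod_cast Nat.factorial_ne_zero _
  have h4 : ((m : ℝ) + j + 1) ≠ 0 := by positivity
  rw [show m + (j + 1) = m + j + 1 by ring, Nat.factorial_succ (m + j)]
  push_cast
  field_simp
  try ring

lemma contDiff_besselClifford (j : ℕ) : ContDiff ℝ ∞ (besselClifford j) := by
  rw [contDiff_infty]
  intro n
  induction n generalizing j with
  | zero =>
    exact contDiff_zero.mpr (continuous_iff_continuousAt.mpr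
      fun z => (hasDerivAt_besselClifford j z).continuousAt)
  | succ n ih =>
    have hd : deriv (besselClifford j) = besselClifford (j + 1) :=
      funext fun z => (hasDerivAt_besselClifford j z).deriv
    push_cast
    rw [contDiff_succ_iff_deriv, hd]
    exact ⟨fun z => (hasDerivAt_besselClifford j z).differentiableAt, by simp, ih (j + 1)⟩

/-- I_1(z)/z is a power series in z², so this form removes the singularity at 0 and lets the square
root in the gain disappear. -/
lemma besselQuot_eq (z : ℝ) : besselQuot z = besselClifford 1 (z ^ 2 / 4) / 2 := by
  unfold besselQuot
  split_ifs with h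
  · subst h
    have : besselClifford 1 0 = 1 := by
      unfold besselClifford
      rw [tsum_eq_single 0]
      · simp
      · intro m hm; simp [hm]
    norm_num [this]
  · have : besselI 1 z = z / 2 * besselClifford 1 (z ^ 2 / 4) := by
      unfold besselI besselClifford
      rw [← tsum_mul_left]
      congr 1
      ext m
      rw [pow_succ, pow_mul, show (z / 2) ^ 2 = z ^ 2 / 4 by ring]
      ring
    rw [this]
    field_simp

/-- The backstepping kernel, which restricts to the gain at `y = 1`. -/
def backKernel (L y η : ℝ) : ℝ := L / 2 * η * besselClifford 1 (L * (y ^ 2 - η ^ 2) / 4)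

/-- The hypotheses keep the argument of `Real.sqrt` nonnegative; for a negative argument the root is
0 and the identity need not hold. -/
lemma gain_eq_backKernel {ε lam c η : ℝ} (hL : 0 ≤ lambda0 ε lam c) (hη : η ∈ Icc (0 : ℝ) 1) :
    gain ε lam c η = backKernel (lambda0 ε lam c) 1 η := by
  have : 0 ≤ lambda0 ε lam c * (1 - η ^ 2) :=
    mul_nonneg hL (by nlinarith [hη.1, hη.2])
  rw [gain, besselQuot_eq, Real.sq_sqrt this, backKernel, one_pow]
  ring

/-- The derivative of the backstepping kernel in its first variable. -/
def backKernelY (L y η : ℝ) : ℝ :=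
  L / 2 * η * (besselClifford 2 (L * (y ^ 2 - η ^ 2) / 4) * (L * y / 2))

/-- The second derivative of the backstepping kernel in its first variable. -/
def backKernelYY (L y η : ℝ) : ℝ :=
  L / 2 * η * (besselClifford 3 (L * (y ^ 2 - η ^ 2) / 4) * (L * y / 2) * (L * y / 2)
    + besselClifford 2 (L * (y ^ 2 - η ^ 2) / 4) * (L / 2))

/-- The derivative of the backstepping kernel in its second variable. -/
def backKernelE (L y η : ℝ) : ℝ :=
  L / 2 * besselClifford 1 (L * (y ^ 2 - η ^ 2) / 4)
    + L / 2 * η * (besselClifford 2 (L * (y ^ 2 - η ^ 2) / 4) * (-(L * η / 2)))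

lemma hasDerivAt_besselClifford_fst (j : ℕ) (L y η : ℝ) :
    HasDerivAt (fun y => besselClifford j (L * (y ^ 2 - η ^ 2) / 4))
      (besselClifford (j + 1) (L * (y ^ 2 - η ^ 2) / 4) * (L * y / 2)) y := by
  refine ((hasDerivAt_besselClifford j _).comp y
    ((((hasDerivAt_pow 2 y).sub_const (η ^ 2)).const_mul L).div_const 4)).congr_deriv ?_
  push_cast
  ring

lemma hasDerivAt_besselClifford_snd (j : ℕ) (L y η : ℝ) :
    HasDerivAt (fun η => besselClifford j (L * (y ^ 2 - η ^ 2) / 4))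
      (besselClifford (j + 1) (L * (y ^ 2 - η ^ 2) / 4) * (-(L * η / 2))) η := by
  refine ((hasDerivAt_besselClifford j _).comp η
    ((((hasDerivAt_pow 2 η).const_sub (y ^ 2)).const_mul L).div_const 4)).congr_deriv ?_
  push_cast
  ring

lemma hasDerivAt_backKernel_fst (L y η : ℝ) :
    HasDerivAt (fun y => backKernel L y η) (backKernelY L y η) y :=
  (hasDerivAt_besselClifford_fst 1 L y η).const_mul _

lemma hasDerivAt_backKernelY_fst (L y η : ℝ) :
    HasDerivAt (fun y => backKernelY L y η) (backKernelYY L y η) y := by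
  refine (((hasDerivAt_besselClifford_fst 2 L y η).mul
    (((hasDerivAt_id y).const_mul L).div_const 2)).const_mul (L / 2 * η)).congr_deriv ?_
  simp only [backKernelYY, id]
  ring

lemma hasDerivAt_backKernel_snd (L y η : ℝ) :
    HasDerivAt (fun η => backKernel L y η) (backKernelE L y η) η := by
  refine ((((hasDerivAt_id η).const_mul (L / 2))).mul
    (hasDerivAt_besselClifford_snd 1 L y η)).congr_deriv ?_
  simp only [backKernelE, id]
  ring

/-- The kernel satisfies the wave-type equation `k_ηη = k_yy - L k`. -/
lemma hasDerivAt_backKernelE_snd (L y η : ℝ) :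
    HasDerivAt (fun η => backKernelE L y η) (backKernelYY L y η - L * backKernel L y η) η := by
  refine (((hasDerivAt_besselClifford_snd 1 L y η).const_mul (L / 2)).add
    ((((hasDerivAt_id η).const_mul (L / 2))).mul ((hasDerivAt_besselClifford_snd 2 L y η).mul
      ((((hasDerivAt_id η).const_mul L).div_const 2).neg)))).congr_deriv ?_
  have h := besselClifford_recurrence 1 (L * (y ^ 2 - η ^ 2) / 4)
  norm_num at h
  simp only [backKernelYY, backKernel, id, ← h, Pi.mul_apply, Pi.neg_apply, mul_one, Nat.reduceAdd]
  ring

lemma continuous_besselClifford_sq (j : ℕ) (L : ℝ) :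
    Continuous fun p : ℝ × ℝ => besselClifford j (L * (p.1 ^ 2 - p.2 ^ 2) / 4) :=
  (contDiff_besselClifford j).continuous.comp (by fun_prop)

lemma continuous_backKernel (L : ℝ) : Continuous fun p : ℝ × ℝ => backKernel L p.1 p.2 := by
  have := continuous_besselClifford_sq 1 L
  unfold backKernel; fun_prop

lemma continuous_backKernelE (L : ℝ) : Continuous fun p : ℝ × ℝ => backKernelE L p.1 p.2 := by
  have := continuous_besselClifford_sq 1 L
  have := continuous_besselClifford_sq 2 L
  unfold backKernelE; fun_prop

lemma continuous_backKernelYY (L : ℝ) : Continuous fun p : ℝ × ℝ => backKernelYY L p.1 p.2 := by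
  have := continuous_besselClifford_sq 3 L
  have := continuous_besselClifford_sq 2 L
  unfold backKernelYY; fun_prop

/-! ### Differentiation of an integral with a moving lower limit -/

/-- Write ∫_e^b k(y,e) dy = ∫_η^b k(y,e) dy - ∫_η^e k(y,e) dy. The first term is differentiated
under the integral; the second has derivative k(η,η) at e = η by joint continuity. -/
lemma hasDerivAt_integral_moving_left {k k' : ℝ → ℝ → ℝ}
    (hk : Continuous fun p : ℝ × ℝ => k p.1 p.2) (hk' : Continuous fun p : ℝ × ℝ => k' p.1 p.2)
    (hd : ∀ y η, HasDerivAt (fun η => k y η) (k' y η) η) (b η : ℝ) :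
    HasDerivAt (fun η => ∫ y in η..b, k y η) (-(k η η) + ∫ y in η..b, k' y η) η := by
  have hint : ∀ (a c e : ℝ), IntervalIntegrable (fun y => k y e) volume a c := fun a c e =>
    Continuous.intervalIntegrable (by fun_prop) _ _
  have h1 : HasDerivAt (fun e => ∫ y in η..b, k y e) (∫ y in η..b, k' y η) η := by
    obtain ⟨C, hC⟩ := (isCompact_uIcc.prod (isCompact_Icc (a := η - 1) (b := η + 1))).exists_bound_of_continuousOn
      (s := uIcc η b ×ˢ Icc (η - 1) (η + 1)) hk'.continuousOn
    refine (intervalIntegral.hasDerivAt_integral_of_dominated_loc_of_deriv_le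
      (F := fun e y => k y e) (F' := fun e y => k' y e) (bound := fun _ => C)
      (s := Icc (η - 1) (η + 1)) (Icc_mem_nhds (by linarith) (by linarith))
      (Eventually.of_forall fun e => ?_) (hint _ _ _) ?_ ?_ (by simp) ?_).2
    · exact Continuous.aestronglyMeasurable (by fun_prop)
    · exact Continuous.aestronglyMeasurable (by fun_prop)
    · exact Eventually.of_forall fun y hy x hx => hC (y, x) ⟨uIoc_subset_uIcc hy, hx⟩
    · exact Eventually.of_forall fun y _ x _ => hd y x
  have h2 : HasDerivAt (fun e => ∫ y in η..e, k y e) (k η η) η := by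
    rw [hasDerivAt_iff_isLittleO, Asymptotics.isLittleO_iff]
    intro δ hδ
    have hc := hk.tendsto (η, η)
    rw [Metric.tendsto_nhds] at hc
    obtain ⟨r, hr, hball⟩ := Metric.eventually_nhds_iff.mp (hc δ hδ)
    filter_upwards [Metric.ball_mem_nhds η hr] with e he
    rw [intervalIntegral.integral_same, sub_zero, smul_eq_mul]
    have : (∫ y in η..e, k y e) - (e - η) * k η η = ∫ y in η..e, (k y e - k η η) := by
      rw [intervalIntegral.integral_sub (hint _ _ _) (by simp)]
      simp
    rw [this, Real.norm_eq_abs (e - η)]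
    refine intervalIntegral.norm_integral_le_of_norm_le_const fun y hy => ?_
    refine (hball (y := (y, e)) ?_).le
    rw [Prod.dist_eq]
    refine max_lt ?_ he
    have h := abs_sub_left_of_mem_uIcc (uIoc_subset_uIcc hy)
    rw [Real.dist_eq]
    rw [Metric.mem_ball, Real.dist_eq] at he
    exact h.trans_lt he
  refine ((h1.sub h2).congr_deriv (by ring)).congr_of_eventuallyEq
    (Eventually.of_forall fun e => ?_)
  have := intervalIntegral.integral_add_adjacent_intervals (hint η e e) (hint e b e)
  simp only [Pi.sub_apply]
  linarith

/-! ### Adjoint backstepping transform of smooth profiles -/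

/-- The adjoint backstepping transform `s ↦ s + ∫_η^1 k(y, η) s(y) dy`. -/
def adjointTransform (L : ℝ) (s : ℝ → ℝ) (η : ℝ) : ℝ :=
  s η + ∫ y in η..1, backKernel L y η * s y

section Adjoint

variable {L κ : ℝ} {s s' : ℝ → ℝ}

lemma adjointTransform_one (h1 : s 1 = 0) : adjointTransform L s 1 = 0 := by
  simp [adjointTransform, h1]

lemma adjointTransform_zero (h0 : s 0 = 0) : adjointTransform L s 0 = 0 := by
  simp [adjointTransform, h0, backKernel]

lemma backKernel_diag (η : ℝ) : backKernel L η η = L / 2 * η := by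
  have : besselClifford 1 0 = 1 := by
    unfold besselClifford
    rw [tsum_eq_single 0]
    · simp
    · intro m hm; simp [hm]
  simp [backKernel, this]

lemma hasDerivAt_adjointTransform (hs : ∀ y, HasDerivAt s (s' y) y) (η : ℝ) :
    HasDerivAt (adjointTransform L s)
      (s' η - L / 2 * η * s η + ∫ y in η..1, backKernelE L y η * s y) η := by
  have hsc : Continuous s := continuous_iff_continuousAt.mpr fun y => (hs y).continuousAt
  have hk := continuous_backKernel L
  have hke := continuous_backKernelE L
  have h := hasDerivAt_integral_moving_left (k := fun y η => backKernel L y η * s y)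
    (k' := fun y η => backKernelE L y η * s y) (by fun_prop) (by fun_prop)
    (fun y η => (hasDerivAt_backKernel_snd L y η).mul_const (s y)) 1 η
  refine ((hs η).add h).congr_deriv ?_
  rw [backKernel_diag]
  ring

/-- Two integrations by parts in y, with antiderivative k_y s - k s'. At y = 1, where s vanishes but
s' need not, the term k(1,η) s'(1) survives; the feedback has to cancel it. -/
lemma integral_backKernelYY_mul (hs : ∀ y, HasDerivAt s (s' y) y)
    (hs' : ∀ y, HasDerivAt s' (-κ * s y) y) (h1 : s 1 = 0) (η : ℝ) :
    ∫ y in η..1, backKernelYY L y η * s y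
      = -backKernel L 1 η * s' 1 - backKernelY L η η * s η + L / 2 * η * s' η
        - κ * ∫ y in η..1, backKernel L y η * s y := by
  have hsc : Continuous s := continuous_iff_continuousAt.mpr fun y => (hs y).continuousAt
  have hk := continuous_backKernel L
  have hkyy := continuous_backKernelYY L
  have hi1 : IntervalIntegrable (fun y => backKernelYY L y η * s y) volume η 1 :=
    Continuous.intervalIntegrable (by fun_prop) _ _
  have hi2 : IntervalIntegrable (fun y => κ * (backKernel L y η * s y)) volume η 1 :=
    Continuous.intervalIntegrable (by fun_prop) _ _
  have h := intervalIntegral.integral_eq_sub_of_hasDerivAt (a := η) (b := 1)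
    (f := fun y => backKernelY L y η * s y - backKernel L y η * s' y)
    (f' := fun y => backKernelYY L y η * s y + κ * (backKernel L y η * s y))
    (fun y _ => by
      refine (((hasDerivAt_backKernelY_fst L y η).mul (hs y)).sub
        ((hasDerivAt_backKernel_fst L y η).mul (hs' y))).congr_deriv ?_
      ring) (hi1.add hi2)
  rw [intervalIntegral.integral_add hi1 hi2, intervalIntegral.integral_const_mul, h1,
    backKernel_diag] at h
  linarith

/-- The adjoint transform of an eigenfunction of `-d²/dy²` solves the adjoint closed-loop
eigenvalue equation, the gain being `k(1, ·)`. -/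
lemma hasDerivAt_deriv_adjointTransform (hs : ∀ y, HasDerivAt s (s' y) y)
    (hs' : ∀ y, HasDerivAt s' (-κ * s y) y) (h1 : s 1 = 0) (η : ℝ) :
    HasDerivAt (deriv (adjointTransform L s))
      (-(κ + L) * adjointTransform L s η - s' 1 * backKernel L 1 η) η := by
  have hsc : Continuous s := continuous_iff_continuousAt.mpr fun y => (hs y).continuousAt
  have hd : deriv (adjointTransform L s) = fun η =>
      s' η - L / 2 * η * s η + ∫ y in η..1, backKernelE L y η * s y :=
    funext fun η => (hasDerivAt_adjointTransform hs η).deriv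
  rw [hd]
  have hk := continuous_backKernel L
  have hke := continuous_backKernelE L
  have hkyy := continuous_backKernelYY L
  have h := hasDerivAt_integral_moving_left (k := fun y η => backKernelE L y η * s y)
    (k' := fun y η => (backKernelYY L y η - L * backKernel L y η) * s y)
    (by fun_prop) (by fun_prop)
    (fun y η => (hasDerivAt_backKernelE_snd L y η).mul_const (s y)) 1 η
  refine (((hs' η).sub (((hasDerivAt_id η).const_mul (L / 2)).mul (hs η))).add h).congr_deriv ?_
  have hi1 : IntervalIntegrable (fun y => backKernelYY L y η * s y) volume η 1 :=
    Continuous.intervalIntegrable (by fun_prop) _ _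
  have hi2 : IntervalIntegrable (fun y => L * (backKernel L y η * s y)) volume η 1 :=
    Continuous.intervalIntegrable (by fun_prop) _ _
  have hsplit : ∫ y in η..1, (backKernelYY L y η - L * backKernel L y η) * s y
      = (∫ y in η..1, backKernelYY L y η * s y) - L * ∫ y in η..1, backKernel L y η * s y := by
    rw [← intervalIntegral.integral_const_mul, ← intervalIntegral.integral_sub hi1 hi2]
    congr 1
    ext y
    ring
  -- k_η + k_y on the diagonal is the derivative of k(η,η) = Lη/2. Together with the L/2 from
  -- differentiating the coefficient of s, it shifts the eigenvalue by exactly L.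
  have hdiag : backKernelE L η η + backKernelY L η η = L / 2 := by
    -- This instance serves only to read off C_1(0) = 1.
    have h := backKernel_diag (L := 2) 1
    simp only [backKernel, sub_self, mul_zero, zero_div] at h
    simp only [backKernelE, backKernelY, sub_self, mul_zero, zero_div]
    have h' : besselClifford 1 0 = 1 := by linarith
    rw [h']
    ring
  rw [hsplit, integral_backKernelYY_mul hs hs' h1, adjointTransform]
  simp only [id, mul_one]
  linear_combination -(s η) * hdiag

lemma deriv_adjointTransform_one (hs : ∀ y, HasDerivAt s (s' y) y) (h1 : s 1 = 0) :
    deriv (adjointTransform L s) 1 = s' 1 := by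
  rw [(hasDerivAt_adjointTransform hs 1).deriv, h1]
  simp

/-- The second derivative is a combination of the function itself and the smooth k(1,·), so
regularity bootstraps. Smoothness is needed because the transform becomes a factor of a test
function. -/
lemma contDiff_adjointTransform (hs : ∀ y, HasDerivAt s (s' y) y)
    (hs' : ∀ y, HasDerivAt s' (-κ * s y) y) (h1 : s 1 = 0) :
    ContDiff ℝ ∞ (adjointTransform L s) := by
  have hd1 : Differentiable ℝ (adjointTransform L s) :=
    fun η => (hasDerivAt_adjointTransform hs η).differentiableAt
  have hd2 : Differentiable ℝ (deriv (adjointTransform L s)) :=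
    fun η => (hasDerivAt_deriv_adjointTransform hs hs' h1 η).differentiableAt
  have hdd : deriv (deriv (adjointTransform L s)) = fun η =>
      -(κ + L) * adjointTransform L s η - s' 1 * backKernel L 1 η :=
    funext fun η => (hasDerivAt_deriv_adjointTransform hs hs' h1 η).deriv
  have hB : ContDiff ℝ ∞ (backKernel L 1) := by
    have := (contDiff_besselClifford 1).comp
      (f := fun η : ℝ => L * (1 ^ 2 - η ^ 2) / 4) (by fun_prop)
    unfold backKernel
    exact (contDiff_const.mul contDiff_id).mul this
  rw [contDiff_infty]
  intro n
  induction n with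
  | zero => exact contDiff_zero.mpr hd1.continuous
  | succ n ih =>
    push_cast
    rw [contDiff_succ_iff_deriv]
    refine ⟨hd1, by simp, ?_⟩
    cases n with
    | zero => exact contDiff_zero.mpr hd2.continuous
    | succ m =>
      push_cast
      rw [contDiff_succ_iff_deriv, hdd]
      refine ⟨hd2, by simp, ?_⟩
      have hm : ContDiff ℝ m (adjointTransform L s) := ih.of_le (by norm_cast; omega)
      exact (contDiff_const.mul hm).sub
        (contDiff_const.mul (hB.of_le (by exact_mod_cast le_top)))

end Adjoint

/-! ### Parseval for the sine system, and its image under the adjoint transform -/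

/-- Lebesgue measure on the unit interval. -/
abbrev unitMeasure : Measure ℝ := (volume : Measure ℝ).restrict (Icc (0 : ℝ) 1)

instance : IsProbabilityMeasure unitMeasure := ⟨by simp [unitMeasure]⟩

/-- The Dirichlet modes `sin ((n + 1) π y)`. -/
def sineMode (n : ℕ) (y : ℝ) : ℝ := Real.sin ((n + 1) * Real.pi * y)

lemma continuous_sineMode (n : ℕ) : Continuous (sineMode n) := by
  unfold sineMode; fun_prop

lemma abs_sineMode_le (n : ℕ) (y : ℝ) : |sineMode n y| ≤ 1 := Real.abs_sin_le_one _

lemma sineMode_zero (n : ℕ) : sineMode n 0 = 0 := by simp [sineMode]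

lemma sineMode_one (n : ℕ) : sineMode n 1 = 0 := by
  have := Real.sin_nat_mul_pi (n + 1)
  push_cast at this
  simpa [sineMode] using this

/-- The derivatives of the Dirichlet modes. -/
def sineModeDeriv (n : ℕ) (y : ℝ) : ℝ :=
  (n + 1) * Real.pi * Real.cos ((n + 1) * Real.pi * y)

lemma hasDerivAt_sineMode (n : ℕ) (y : ℝ) : HasDerivAt (sineMode n) (sineModeDeriv n y) y := by
  have h := ((hasDerivAt_id y).const_mul (((n : ℝ) + 1) * Real.pi)).sin
  refine h.congr_deriv ?_
  simp only [sineModeDeriv, id]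
  ring

lemma hasDerivAt_sineModeDeriv (n : ℕ) (y : ℝ) :
    HasDerivAt (sineModeDeriv n) (-(((n + 1) * Real.pi) ^ 2) * sineMode n y) y := by
  have h := (((hasDerivAt_id y).const_mul (((n : ℝ) + 1) * Real.pi)).cos).const_mul
    (((n : ℝ) + 1) * Real.pi)
  refine h.congr_deriv ?_
  simp only [sineMode, id]
  ring

lemma integral_unitMeasure (f : ℝ → ℝ) : ∫ y, f y ∂unitMeasure = ∫ y in (0 : ℝ)..1, f y := by
  rw [intervalIntegral.integral_of_le zero_le_one, integral_Icc_eq_integral_Ioc]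

/-- The cosine part integrates to zero against an odd function. Completeness of the sine system on
[0,1] is thus inherited from that of the exponentials on (-1,1). -/
lemma fourierCoeffOn_odd_extension {r : ℝ → ℝ} (hr : MemLp r 2 unitMeasure) (n : ℤ) :
    fourierCoeffOn (show (-1 : ℝ) < 1 by norm_num)
      (fun x => (((if 0 < x then r x else -r (-x)) : ℝ) : ℂ)) n
      = -Complex.I * ((∫ y, r y * Real.sin (n * Real.pi * y) ∂unitMeasure : ℝ) : ℂ) := by
  have hri : IntervalIntegrable r volume 0 1 := by
    rw [intervalIntegrable_iff_integrableOn_Icc_of_le zero_le_one]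
    exact (hr.integrable (by norm_num))
  have hrc : IntervalIntegrable (fun x => (r x : ℂ)) volume 0 1 :=
    ⟨hri.1.ofReal, hri.2.ofReal⟩
  rw [fourierCoeffOn_eq_integral]
  set E : ℝ → ℂ := fun x => Complex.exp (-(n * Real.pi * x : ℝ) * Complex.I) with hE
  have hEc : Continuous E := by fun_prop
  have hfour : ∀ x : ℝ, (fourier (-n) (x : AddCircle ((1 : ℝ) - -1)) : ℂ) = E x := by
    intro x
    rw [fourier_coe_apply, hE]
    congr 1
    push_cast
    ring
  simp only [hfour, smul_eq_mul]
  have hpos : ∫ x in (0 : ℝ)..1, E x * (((if 0 < x then r x else -r (-x)) : ℝ) : ℂ)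
      = ∫ x in (0 : ℝ)..1, E x * r x := by
    refine intervalIntegral.integral_congr_ae (Eventually.of_forall fun x hx => ?_)
    rw [uIoc_of_le zero_le_one] at hx
    simp [hx.1]
  have hneg : ∫ x in (-1 : ℝ)..0, E x * (((if 0 < x then r x else -r (-x)) : ℝ) : ℂ)
      = -∫ x in (0 : ℝ)..1, E (-x) * r x := by
    rw [← neg_zero, ← intervalIntegral.integral_comp_neg, ← intervalIntegral.integral_neg]
    rw [neg_zero]
    refine intervalIntegral.integral_congr_ae (Eventually.of_forall fun x hx => ?_)
    rw [uIoc_of_le zero_le_one] at hx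
    have : ¬ 0 < -x := by linarith [hx.1]
    simp [this]
  have i1 : IntervalIntegrable (fun x => E x * (((if 0 < x then r x else -r (-x)) : ℝ) : ℂ))
      volume 0 1 := by
    refine IntervalIntegrable.continuousOn_mul ?_ hEc.continuousOn
    refine hrc.congr fun x hx => ?_
    rw [uIoc_of_le zero_le_one] at hx
    simp [hx.1]
  have i2 : IntervalIntegrable (fun x => E x * (((if 0 < x then r x else -r (-x)) : ℝ) : ℂ))
      volume (-1) 0 := by
    refine IntervalIntegrable.continuousOn_mul ?_ hEc.continuousOn
    have h := (hrc.comp_sub_left 0).neg.symm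
    simp only [zero_sub, sub_zero] at h
    refine h.congr fun x hx => ?_
    rw [uIoc_of_le (by norm_num)] at hx
    simp [not_lt.mpr hx.2]
  rw [← intervalIntegral.integral_add_adjacent_intervals i2 i1, hpos, hneg, integral_unitMeasure,
    ← intervalIntegral.integral_ofReal, ← intervalIntegral.integral_const_mul]
  have j1 : IntervalIntegrable (fun x => E x * (r x : ℂ)) volume 0 1 :=
    hrc.continuousOn_mul hEc.continuousOn
  have j2 : IntervalIntegrable (fun x => E (-x) * (r x : ℂ)) volume 0 1 :=
    hrc.continuousOn_mul (by fun_prop)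
  rw [neg_add_eq_sub, ← intervalIntegral.integral_sub j1 j2, ← intervalIntegral.integral_smul]
  congr 1
  ext x
  have hsin : Complex.exp (-(n * Real.pi * x : ℝ) * Complex.I)
      - Complex.exp ((n * Real.pi * x : ℝ) * Complex.I)
        = -2 * Complex.I * ((Real.sin (n * Real.pi * x) : ℝ) : ℂ) := by
    rw [Complex.ofReal_sin, Complex.sin]
    linear_combination (Complex.exp (-(n * Real.pi * x : ℝ) * Complex.I)
      - Complex.exp ((n * Real.pi * x : ℝ) * Complex.I)) * Complex.I_sq
  have hE2 : E (-x) = Complex.exp ((n * Real.pi * x : ℝ) * Complex.I) := by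
    simp only [hE]; congr 2; push_cast; ring
  rw [hE2, ← sub_mul, hE]
  simp only
  rw [hsin, Complex.real_smul]
  push_cast
  ring

lemma memLp_odd_extension {r : ℝ → ℝ} (hr : MemLp r 2 unitMeasure) :
    MemLp (fun x => (((if 0 < x then r x else -r (-x)) : ℝ) : ℂ)) 2
      (volume.restrict (Ioc (-1 : ℝ) 1)) := by
  have h1 : MemLp r 2 (volume.restrict (Ioc (0 : ℝ) 1)) :=
    hr.mono_measure (Measure.restrict_mono Ioc_subset_Icc_self le_rfl)
  have h2 : MemLp (fun x => r (-x)) 2 (volume.restrict (Ioc (-1 : ℝ) 0)) := by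
    have hmp : MeasurePreserving (fun x : ℝ => -x) (volume.restrict (Icc (-1 : ℝ) 0))
        (volume.restrict (Icc (0 : ℝ) 1)) := by
      have := (Measure.measurePreserving_neg (volume : Measure ℝ)).restrict_preimage
        (measurableSet_Icc (a := (0 : ℝ)) (b := 1))
      convert this using 2
      ext x
      simp only [mem_Icc, mem_preimage]
      constructor <;> rintro ⟨a, b⟩ <;> constructor <;> linarith
    exact (hr.comp_measurePreserving hmp).mono_measure
      (Measure.restrict_mono Ioc_subset_Icc_self le_rfl)
  have k := MemLp.piecewise (μ := volume.restrict (Ioc (-1 : ℝ) 1)) (s := Ioi (0 : ℝ)) (f := r)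
    (g := fun x => -r (-x)) (p := 2) measurableSet_Ioi
    (by
      rw [Measure.restrict_restrict measurableSet_Ioi]
      refine h1.mono_measure (Measure.restrict_mono ?_ le_rfl)
      rintro x ⟨a, b⟩; exact ⟨a, b.2⟩)
    (by
      rw [Measure.restrict_restrict measurableSet_Ioi.compl]
      refine h2.neg.mono_measure (Measure.restrict_mono ?_ le_rfl)
      rintro x ⟨a, b⟩; exact ⟨b.1, not_lt.mp a⟩)
  have e : (fun x => if 0 < x then r x else -r (-x))
      = (Ioi (0 : ℝ)).piecewise r fun x => -r (-x) := by
    ext x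
    by_cases h : 0 < x
    · rw [Set.piecewise_eq_of_mem _ _ _ (mem_Ioi.mpr h), if_pos h]
    · rw [Set.piecewise_eq_of_notMem _ _ _ (by simpa using h), if_neg h]
  rw [← e] at k
  exact k.ofReal

/-- Parseval's identity for the sine system on the unit interval. -/
lemma hasSum_sq_sineMode {r : ℝ → ℝ} (hr : MemLp r 2 unitMeasure) :
    HasSum (fun n : ℕ => 2 * (∫ y, r y * sineMode n y ∂unitMeasure) ^ 2)
      (∫ y, r y ^ 2 ∂unitMeasure) := by
  have hri : IntervalIntegrable (fun x => r x ^ 2) volume 0 1 := by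
    rw [intervalIntegrable_iff_integrableOn_Icc_of_le zero_le_one]
    exact hr.integrable_sq
  have h := hasSum_sq_fourierCoeffOn (show (-1 : ℝ) < 1 by norm_num) (memLp_odd_extension hr)
  have hfc : ∀ n : ℤ, ‖fourierCoeffOn (show (-1 : ℝ) < 1 by norm_num)
      (fun x => (((if 0 < x then r x else -r (-x)) : ℝ) : ℂ)) n‖ ^ 2
        = (∫ y, r y * Real.sin (n * Real.pi * y) ∂unitMeasure) ^ 2 := by
    intro n
    rw [fourierCoeffOn_odd_extension hr, norm_mul, norm_neg, Complex.norm_I, one_mul,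
      Complex.norm_real, Real.norm_eq_abs, sq_abs]
  simp only [hfc] at h
  have hval : ((1 : ℝ) - -1)⁻¹ • ∫ x in (-1 : ℝ)..1,
      ‖(((if 0 < x then r x else -r (-x)) : ℝ) : ℂ)‖ ^ 2 = ∫ y, r y ^ 2 ∂unitMeasure := by
    have e1 : ∫ x in (0 : ℝ)..1, ‖(((if 0 < x then r x else -r (-x)) : ℝ) : ℂ)‖ ^ 2
        = ∫ x in (0 : ℝ)..1, r x ^ 2 := by
      refine intervalIntegral.integral_congr_ae (Eventually.of_forall fun x hx => ?_)
      rw [uIoc_of_le zero_le_one] at hx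
      simp [hx.1]
    have e2 : ∫ x in (-1 : ℝ)..0, ‖(((if 0 < x then r x else -r (-x)) : ℝ) : ℂ)‖ ^ 2
        = ∫ x in (0 : ℝ)..1, r x ^ 2 := by
      rw [← neg_zero, ← intervalIntegral.integral_comp_neg, neg_zero]
      refine intervalIntegral.integral_congr_ae (Eventually.of_forall fun x hx => ?_)
      rw [uIoc_of_le zero_le_one] at hx
      have : ¬ 0 < -x := by linarith [hx.1]
      simp [this]
    have i0 : IntervalIntegrable (fun x => ‖(((if 0 < x then r x else -r (-x)) : ℝ) : ℂ)‖ ^ 2)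
        volume (-1) 1 := by
      rw [intervalIntegrable_iff_integrableOn_Ioc_of_le (by norm_num)]
      exact (memLp_odd_extension hr).integrable_norm_pow (by norm_num)
    rw [← intervalIntegral.integral_add_adjacent_intervals (b := 0)
      (i0.mono_set (by rw [uIcc_of_le, uIcc_of_le] <;> first | exact Icc_subset_Icc (by norm_num) (by norm_num) | norm_num))
      (i0.mono_set (by rw [uIcc_of_le, uIcc_of_le] <;> first | exact Icc_subset_Icc (by norm_num) (by norm_num) | norm_num)),
      e1, e2, integral_unitMeasure, smul_eq_mul]
    ring
  rw [hval] at h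
  -- The sine integrals are odd in n, so n and -n carry equal squares, which produces the factor 2.
  -- Frequency 0 contributes nothing, and the shift by one matches the frequencies (n + 1)π of
  -- `sineMode`.
  have h2 := h.nat_add_neg
  simp only [Int.cast_neg, Int.cast_natCast, neg_mul, Real.sin_neg, mul_neg, integral_neg,
    neg_sq, Int.cast_zero, zero_mul, Real.sin_zero, mul_zero, integral_zero, ne_eq,
    OfNat.ofNat_ne_zero, not_false_eq_true, zero_pow, add_zero] at h2
  rw [← hasSum_nat_add_iff' 1] at h2
  simp only [Finset.range_one, Finset.sum_singleton, Nat.cast_zero, zero_mul, Real.sin_zero,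
    mul_zero, integral_zero, ne_eq, OfNat.ofNat_ne_zero, not_false_eq_true, zero_pow, add_zero,
    sub_zero, Nat.cast_add, Nat.cast_one] at h2
  refine h2.congr_fun fun n => ?_
  simp only [sineMode]
  ring

lemma enorm_sq_eq_ofReal (x : ℝ) : ‖x‖ₑ ^ 2 = ENNReal.ofReal (x ^ 2) := by
  rw [Real.enorm_eq_ofReal_abs, ← ENNReal.ofReal_pow (abs_nonneg x), sq_abs]

lemma tsum_enorm_sq_sineMode {r : ℝ → ℝ} (hr : MemLp r 2 unitMeasure) :
    2 * ∑' n : ℕ, ‖∫ y, r y * sineMode n y ∂unitMeasure‖ₑ ^ 2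
      = ENNReal.ofReal (∫ y, r y ^ 2 ∂unitMeasure) := by
  have h := hasSum_sq_sineMode hr
  rw [← h.tsum_eq, ENNReal.ofReal_tsum_of_nonneg (fun n => by positivity) h.summable,
    ← ENNReal.tsum_mul_left]
  congr 1
  ext n
  rw [enorm_sq_eq_ofReal, ENNReal.ofReal_mul (by norm_num), ENNReal.ofReal_ofNat]

/-! ### Bounds for Volterra operators on the unit interval -/

/-- The kernel `k(y, η)` restricted to the triangle `η ≤ y`. -/
def triKernel (L y η : ℝ) : ℝ := if η ≤ y then backKernel L y η else 0

/-- The Volterra part of the backstepping transform. -/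
def volterra (L : ℝ) (r : ℝ → ℝ) (y : ℝ) : ℝ := ∫ η, triKernel L y η * r η ∂unitMeasure

lemma measurable_triKernel (L : ℝ) : Measurable fun p : ℝ × ℝ => triKernel L p.1 p.2 :=
  Measurable.ite (measurableSet_le measurable_snd measurable_fst)
    (continuous_backKernel L).measurable measurable_const

lemma exists_triKernel_bound (L : ℝ) : ∃ C : ℝ, 1 ≤ C ∧
    ∀ y ∈ Icc (0 : ℝ) 1, ∀ η ∈ Icc (0 : ℝ) 1, |triKernel L y η| ≤ C := by
  obtain ⟨C, hC⟩ := (isCompact_Icc.prod (isCompact_Icc (a := (0 : ℝ)) (b := 1))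
    ).exists_bound_of_continuousOn (s := Icc (0 : ℝ) 1 ×ˢ Icc (0 : ℝ) 1)
    (continuous_backKernel L).continuousOn
  refine ⟨max C 1, le_max_right _ _, fun y hy η hη => ?_⟩
  unfold triKernel
  split_ifs
  · exact (hC (y, η) ⟨hy, hη⟩).trans (le_max_left _ _)
  · simp

lemma adjointTransform_eq (L : ℝ) (s : ℝ → ℝ) {η : ℝ} (hη : η ∈ Icc (0 : ℝ) 1) :
    adjointTransform L s η = s η + ∫ y, triKernel L y η * s y ∂unitMeasure := by
  have : ∀ y, triKernel L y η * s y = (Ici η).indicator (fun y => backKernel L y η * s y) y := by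
    intro y
    by_cases h : η ≤ y <;> simp [triKernel, h]
  simp only [adjointTransform, this]
  rw [integral_indicator measurableSet_Ici, Measure.restrict_restrict measurableSet_Ici,
    intervalIntegral.integral_of_le hη.2, ← integral_Icc_eq_integral_Ioc]
  congr 3
  ext y
  simp only [mem_Icc, mem_inter_iff, mem_Ici]
  constructor
  · rintro ⟨a, b⟩; exact ⟨a, hη.1.trans a, b⟩
  · rintro ⟨a, b⟩; exact ⟨a, b.2⟩

lemma sq_integral_le_integral_sq {f : ℝ → ℝ} (hf : MemLp f 2 unitMeasure) :
    (∫ y, f y ∂unitMeasure) ^ 2 ≤ ∫ y, f y ^ 2 ∂unitMeasure := by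
  have h1 : Integrable f unitMeasure := hf.integrable (by norm_num)
  have h2 := hf.integrable_sq
  set m := ∫ y, f y ∂unitMeasure with hm
  have h3 : 0 ≤ ∫ y, (f y - m) ^ 2 ∂unitMeasure := integral_nonneg fun y => sq_nonneg _
  have h4 : ∫ y, (f y - m) ^ 2 ∂unitMeasure = (∫ y, f y ^ 2 ∂unitMeasure) - 2 * m * m + m ^ 2 := by
    have : ∀ y, (f y - m) ^ 2 = (f y ^ 2 - 2 * m * f y) + m ^ 2 := fun y => by ring
    simp only [this]
    have h5 : Integrable (fun y => 2 * m * f y) unitMeasure := h1.const_mul _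
    have h6 : Integrable (fun y => f y ^ 2 - 2 * m * f y) unitMeasure := h2.sub h5
    rw [integral_add h6 (integrable_const _), integral_sub h2 h5, integral_const_mul]
    simp [hm]
  nlinarith

section Volterra

variable {L C : ℝ} {r : ℝ → ℝ}

lemma memLp_triKernel_mul (hC : ∀ y ∈ Icc (0 : ℝ) 1, ∀ η ∈ Icc (0 : ℝ) 1, |triKernel L y η| ≤ C)
    (hr : MemLp r 2 unitMeasure) {y : ℝ} (hy : y ∈ Icc (0 : ℝ) 1) :
    MemLp (fun η => triKernel L y η * r η) 2 unitMeasure := by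
  refine (hr.const_mul C).mono (((measurable_triKernel L).comp
    measurable_prodMk_left).aestronglyMeasurable.mul hr.aestronglyMeasurable) ?_
  filter_upwards [ae_restrict_mem measurableSet_Icc] with η hη
  rw [norm_mul, norm_mul, Real.norm_eq_abs, Real.norm_eq_abs C]
  exact mul_le_mul_of_nonneg_right ((hC y hy η hη).trans (le_abs_self C)) (norm_nonneg _)

lemma integral_ite_sq_le (hr : MemLp r 2 unitMeasure) (y : ℝ) :
    ∫ η, (if η ≤ y then r η ^ 2 else 0) ∂unitMeasure ≤ ∫ η, r η ^ 2 ∂unitMeasure := by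
  refine integral_mono_of_nonneg (Eventually.of_forall fun η => ?_) hr.integrable_sq
    (Eventually.of_forall fun η => ?_)
  · dsimp only [Pi.zero_apply]; split_ifs <;> positivity
  · dsimp only; split_ifs
    · exact le_rfl
    · positivity

/-- Cauchy–Schwarz, keeping the restriction η ≤ y: the exponential weight below exploits it. -/
lemma sq_volterra_le (hC : ∀ y ∈ Icc (0 : ℝ) 1, ∀ η ∈ Icc (0 : ℝ) 1, |triKernel L y η| ≤ C)
    (hr : MemLp r 2 unitMeasure) {y : ℝ} (hy : y ∈ Icc (0 : ℝ) 1) :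
    volterra L r y ^ 2 ≤ C ^ 2 * ∫ η, (if η ≤ y then r η ^ 2 else 0) ∂unitMeasure := by
  have hm := memLp_triKernel_mul hC hr hy
  refine (sq_integral_le_integral_sq hm).trans ?_
  rw [← integral_const_mul]
  have hi : Integrable (fun η => if η ≤ y then r η ^ 2 else 0) unitMeasure := by
    have := hr.integrable_sq.indicator (measurableSet_Iic (a := y))
    refine this.congr (Eventually.of_forall fun η => ?_)
    by_cases h : η ≤ y <;> simp [h]
  refine integral_mono_ae hm.integrable_sq (hi.const_mul _) ?_
  filter_upwards [ae_restrict_mem measurableSet_Icc] with η hη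
  have h1 := hC y hy η hη
  by_cases h : η ≤ y
  · simp only [h, if_true, mul_pow]
    exact mul_le_mul_of_nonneg_right (sq_le_sq' (by linarith [abs_le.mp h1]) (abs_le.mp h1).2)
      (sq_nonneg _)
  · simp [triKernel, h]

lemma aestronglyMeasurable_volterra (hr : MemLp r 2 unitMeasure) :
    AEStronglyMeasurable (volterra L r) unitMeasure :=
  AEStronglyMeasurable.integral_prod_right'
    (f := fun p : ℝ × ℝ => triKernel L p.1 p.2 * r p.2) (μ := unitMeasure) (ν := unitMeasure)
    ((measurable_triKernel L).aestronglyMeasurable.mul hr.aestronglyMeasurable.comp_snd)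

lemma memLp_volterra (hC : ∀ y ∈ Icc (0 : ℝ) 1, ∀ η ∈ Icc (0 : ℝ) 1, |triKernel L y η| ≤ C)
    (hr : MemLp r 2 unitMeasure) : MemLp (volterra L r) 2 unitMeasure := by
  refine MemLp.of_bound (aestronglyMeasurable_volterra hr)
    (Real.sqrt (C ^ 2 * ∫ η, r η ^ 2 ∂unitMeasure)) ?_
  filter_upwards [ae_restrict_mem measurableSet_Icc] with y hy
  rw [Real.norm_eq_abs]
  exact Real.abs_le_sqrt ((sq_volterra_le hC hr hy).trans
    (mul_le_mul_of_nonneg_left (integral_ite_sq_le hr y) (sq_nonneg C)))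

/-- After exchanging the integrals the weight contributes ∫_η^1 e^{-σy} dy ≤ e^{-ση}/σ. In this norm
the Volterra operator is as small as desired for large σ, which replaces a Neumann series for the
inverse. -/
lemma integral_weight_sq_volterra_le
    (hC : ∀ y ∈ Icc (0 : ℝ) 1, ∀ η ∈ Icc (0 : ℝ) 1, |triKernel L y η| ≤ C)
    (hr : MemLp r 2 unitMeasure) {σ : ℝ} (hσ : 0 < σ) :
    ∫ y, Real.exp (-σ * y) * volterra L r y ^ 2 ∂unitMeasure
      ≤ C ^ 2 / σ * ∫ y, Real.exp (-σ * y) * r y ^ 2 ∂unitMeasure := by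
  have hexp : ∀ y ∈ Icc (0 : ℝ) 1, Real.exp (-σ * y) ≤ 1 := fun y hy =>
    Real.exp_le_one_iff.mpr (by nlinarith [hy.1])
  have hbdd : ∀ {f : ℝ → ℝ}, Integrable f unitMeasure →
      Integrable (fun y => Real.exp (-σ * y) * f y) unitMeasure := by
    intro f hf
    refine hf.mono ((Continuous.aestronglyMeasurable (by fun_prop)).mul hf.aestronglyMeasurable) ?_
    filter_upwards [ae_restrict_mem measurableSet_Icc] with y hy
    rw [norm_mul, Real.norm_of_nonneg (Real.exp_pos _).le]
    exact mul_le_of_le_one_left (norm_nonneg _) (hexp y hy)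
  have hprod : Integrable (fun p : ℝ × ℝ => Real.exp (-σ * p.1) *
      (if p.2 ≤ p.1 then r p.2 ^ 2 else 0)) (unitMeasure.prod unitMeasure) := by
    have h0 : Integrable (fun p : ℝ × ℝ => r p.2 ^ 2) (unitMeasure.prod unitMeasure) :=
      hr.integrable_sq.comp_snd _
    have h1 : AEStronglyMeasurable (fun p : ℝ × ℝ => if p.2 ≤ p.1 then r p.2 ^ 2 else 0)
        (unitMeasure.prod unitMeasure) := by
      have := h0.aestronglyMeasurable.indicator
        (measurableSet_le (measurable_snd (α := ℝ) (β := ℝ)) measurable_fst)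
      refine this.congr (Eventually.of_forall fun p => ?_)
      by_cases h : p.2 ≤ p.1 <;> simp [h]
    refine h0.mono ((Continuous.aestronglyMeasurable (by fun_prop)).mul h1) ?_
    have hmem : ∀ᵐ p ∂(unitMeasure.prod unitMeasure), p.1 ∈ Icc (0 : ℝ) 1 :=
      Measure.quasiMeasurePreserving_fst.ae (ae_restrict_mem measurableSet_Icc)
    filter_upwards [hmem] with p hp
    rw [norm_mul, Real.norm_of_nonneg (Real.exp_pos _).le]
    split_ifs
    · exact mul_le_of_le_one_left (norm_nonneg _) (hexp _ hp)
    · simpa using sq_nonneg (r p.2)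
  calc ∫ y, Real.exp (-σ * y) * volterra L r y ^ 2 ∂unitMeasure
      ≤ ∫ y, C ^ 2 * ∫ η, Real.exp (-σ * y) * (if η ≤ y then r η ^ 2 else 0) ∂unitMeasure
          ∂unitMeasure := by
        refine integral_mono_ae (hbdd (memLp_volterra hC hr).integrable_sq)
          (hprod.integral_prod_left.const_mul _) ?_
        filter_upwards [ae_restrict_mem measurableSet_Icc] with y hy
        rw [integral_const_mul]
        have := mul_le_mul_of_nonneg_left (sq_volterra_le hC hr hy) (Real.exp_pos (-σ * y)).le
        linarith
    _ = C ^ 2 * ∫ η, (∫ y, Real.exp (-σ * y) * (if η ≤ y then r η ^ 2 else 0) ∂unitMeasure)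
          ∂unitMeasure := by
        rw [integral_const_mul]
        congr 1
        exact integral_integral_swap hprod
    _ ≤ C ^ 2 * ∫ η, 1 / σ * (Real.exp (-σ * η) * r η ^ 2) ∂unitMeasure := by
        refine mul_le_mul_of_nonneg_left ?_ (sq_nonneg C)
        refine integral_mono_ae hprod.integral_prod_right
          ((hbdd hr.integrable_sq).const_mul _) ?_
        filter_upwards [ae_restrict_mem measurableSet_Icc] with η hη
        have e1 : ∫ y, Real.exp (-σ * y) * (if η ≤ y then r η ^ 2 else 0) ∂unitMeasure
            = (∫ y in η..1, Real.exp (-σ * y)) * r η ^ 2 := by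
          have : ∀ y, Real.exp (-σ * y) * (if η ≤ y then r η ^ 2 else 0)
              = (Ici η).indicator (fun y => Real.exp (-σ * y)) y * r η ^ 2 := by
            intro y
            by_cases h : η ≤ y <;> simp [h]
          simp only [this]
          rw [integral_mul_const, integral_indicator measurableSet_Ici,
            Measure.restrict_restrict measurableSet_Ici,
            intervalIntegral.integral_of_le hη.2, ← integral_Icc_eq_integral_Ioc]
          have hset : Ici η ∩ Icc 0 1 = Icc η 1 := by
            ext y
            simp only [mem_Icc, mem_inter_iff, mem_Ici]
            exact ⟨fun h => ⟨h.1, h.2.2⟩, fun h => ⟨h.1, hη.1.trans h.1, h.2⟩⟩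
          rw [hset]
        have e2 : ∫ y in η..1, Real.exp (-σ * y)
            = (Real.exp (-σ * η) - Real.exp (-σ * 1)) / σ := by
          rw [intervalIntegral.integral_comp_mul_left (fun y => Real.exp y) (by linarith : -σ ≠ 0),
            integral_exp, smul_eq_mul]
          field_simp
          ring
        rw [e1, e2]
        have := Real.exp_pos (-σ * 1)
        calc (Real.exp (-σ * η) - Real.exp (-σ * 1)) / σ * r η ^ 2
            ≤ Real.exp (-σ * η) / σ * r η ^ 2 := by gcongr; linarith
          _ = 1 / σ * (Real.exp (-σ * η) * r η ^ 2) := by ring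
    _ = C ^ 2 / σ * ∫ y, Real.exp (-σ * y) * r y ^ 2 ∂unitMeasure := by
        rw [integral_const_mul]
        ring

/-- The backstepping transform is bounded on `L²`. -/
lemma integral_sq_transform_le
    (hC : ∀ y ∈ Icc (0 : ℝ) 1, ∀ η ∈ Icc (0 : ℝ) 1, |triKernel L y η| ≤ C)
    (hr : MemLp r 2 unitMeasure) :
    ∫ y, (r y + volterra L r y) ^ 2 ∂unitMeasure ≤ (2 + 2 * C ^ 2) * ∫ y, r y ^ 2 ∂unitMeasure := by
  have hv := memLp_volterra hC hr
  have hR : 0 ≤ ∫ y, r y ^ 2 ∂unitMeasure := integral_nonneg fun y => sq_nonneg _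
  have h1 : ∫ y, volterra L r y ^ 2 ∂unitMeasure ≤ C ^ 2 * ∫ y, r y ^ 2 ∂unitMeasure := by
    have : ∫ y, volterra L r y ^ 2 ∂unitMeasure
        ≤ ∫ _y, C ^ 2 * ∫ y, r y ^ 2 ∂unitMeasure ∂unitMeasure := by
      refine integral_mono_ae hv.integrable_sq (integrable_const _) ?_
      filter_upwards [ae_restrict_mem measurableSet_Icc] with y hy
      exact (sq_volterra_le hC hr hy).trans
        (mul_le_mul_of_nonneg_left (integral_ite_sq_le hr y) (sq_nonneg C))
    simpa using this
  calc ∫ y, (r y + volterra L r y) ^ 2 ∂unitMeasure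
      ≤ ∫ y, (2 * r y ^ 2 + 2 * volterra L r y ^ 2) ∂unitMeasure := by
        refine integral_mono (hr.add hv).integrable_sq
          ((hr.integrable_sq.const_mul 2).add (hv.integrable_sq.const_mul 2)) fun y => ?_
        simp only
        nlinarith [sq_nonneg (r y - volterra L r y)]
    _ = 2 * ∫ y, r y ^ 2 ∂unitMeasure + 2 * ∫ y, volterra L r y ^ 2 ∂unitMeasure := by
        rw [integral_add (hr.integrable_sq.const_mul 2) (hv.integrable_sq.const_mul 2),
          integral_const_mul, integral_const_mul]
    _ ≤ _ := by linarith

/-- The backstepping transform is bounded below on `L²`. -/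
lemma integral_sq_le_transform (hC1 : 1 ≤ C)
    (hC : ∀ y ∈ Icc (0 : ℝ) 1, ∀ η ∈ Icc (0 : ℝ) 1, |triKernel L y η| ≤ C)
    (hr : MemLp r 2 unitMeasure) :
    ∫ y, r y ^ 2 ∂unitMeasure
      ≤ 4 * Real.exp (4 * C ^ 2) * ∫ y, (r y + volterra L r y) ^ 2 ∂unitMeasure := by
  have hv := memLp_volterra hC hr
  -- This makes C²/σ = 1/4, so the Volterra term takes at most half of the weighted integral of r²
  -- and is absorbed. Removing the weight costs the factor e^σ.
  set σ : ℝ := 4 * C ^ 2 with hσdef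
  have hσ : 0 < σ := by positivity
  have hbdd : ∀ {f : ℝ → ℝ}, Integrable f unitMeasure →
      Integrable (fun y => Real.exp (-σ * y) * f y) unitMeasure := by
    intro f hf
    refine hf.mono ((Continuous.aestronglyMeasurable (by fun_prop)).mul hf.aestronglyMeasurable) ?_
    filter_upwards [ae_restrict_mem measurableSet_Icc] with y hy
    rw [norm_mul, Real.norm_of_nonneg (Real.exp_pos _).le]
    exact mul_le_of_le_one_left (norm_nonneg _)
      (Real.exp_le_one_iff.mpr (by nlinarith [hy.1]))
  have h1 := integral_weight_sq_volterra_le hC hr hσ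
  have hw : Integrable (fun y => (r y + volterra L r y) ^ 2) unitMeasure :=
    (hr.add hv).integrable_sq
  have h2 : ∫ y, Real.exp (-σ * y) * r y ^ 2 ∂unitMeasure
      ≤ 2 * ∫ y, Real.exp (-σ * y) * (r y + volterra L r y) ^ 2 ∂unitMeasure
        + 2 * ∫ y, Real.exp (-σ * y) * volterra L r y ^ 2 ∂unitMeasure := by
    rw [← integral_const_mul, ← integral_const_mul,
      ← integral_add ((hbdd hw).const_mul 2) ((hbdd hv.integrable_sq).const_mul 2)]
    refine integral_mono (hbdd hr.integrable_sq)
      (((hbdd hw).const_mul 2).add ((hbdd hv.integrable_sq).const_mul 2)) fun y => ?_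
    have := Real.exp_pos (-σ * y)
    simp only
    -- With V the Volterra term, 2(r + V)² + 2V² - r² = (r + 2V)².
    nlinarith [mul_nonneg this.le (sq_nonneg (r y + 2 * volterra L r y))]
  have h3 : ∫ y, Real.exp (-σ * y) * (r y + volterra L r y) ^ 2 ∂unitMeasure
      ≤ ∫ y, (r y + volterra L r y) ^ 2 ∂unitMeasure := by
    refine integral_mono_ae (hbdd hw) hw ?_
    filter_upwards [ae_restrict_mem measurableSet_Icc] with y hy
    exact mul_le_of_le_one_left (sq_nonneg _) (Real.exp_le_one_iff.mpr (by nlinarith [hy.1]))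
  have h4 : Real.exp (-σ) * ∫ y, r y ^ 2 ∂unitMeasure
      ≤ ∫ y, Real.exp (-σ * y) * r y ^ 2 ∂unitMeasure := by
    rw [← integral_const_mul]
    refine integral_mono_ae (hr.integrable_sq.const_mul _) (hbdd hr.integrable_sq) ?_
    filter_upwards [ae_restrict_mem measurableSet_Icc] with y hy
    refine mul_le_mul_of_nonneg_right (Real.exp_le_exp.mpr ?_) (sq_nonneg _)
    nlinarith [hy.2]
  have h5 : C ^ 2 / σ = 1 / 4 := by rw [hσdef]; field_simp
  rw [h5] at h1
  have h6 : Real.exp (-σ) * ∫ y, r y ^ 2 ∂unitMeasure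
      ≤ 4 * ∫ y, (r y + volterra L r y) ^ 2 ∂unitMeasure := by linarith
  have h7 := mul_le_mul_of_nonneg_left h6 (Real.exp_pos σ).le
  rw [← mul_assoc, ← Real.exp_add, add_neg_cancel, Real.exp_zero, one_mul] at h7
  linarith

/-- Fubini on the triangle η ≤ y. The adjoint transform on the mode becomes the backstepping
transform on the state. -/
lemma integral_mul_adjointTransform
    (hC : ∀ y ∈ Icc (0 : ℝ) 1, ∀ η ∈ Icc (0 : ℝ) 1, |triKernel L y η| ≤ C)
    (hr : MemLp r 2 unitMeasure) {s : ℝ → ℝ} (hs : Continuous s) (hs1 : ∀ y, |s y| ≤ 1) :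
    ∫ y, r y * adjointTransform L s y ∂unitMeasure
      = ∫ y, (r y + volterra L r y) * s y ∂unitMeasure := by
  have hri : Integrable r unitMeasure := hr.integrable (by norm_num)
  have hvi : Integrable (volterra L r) unitMeasure :=
    (memLp_volterra hC hr).integrable (by norm_num)
  have hprod : Integrable (fun p : ℝ × ℝ => triKernel L p.1 p.2 * s p.1 * r p.2)
      (unitMeasure.prod unitMeasure) := by
    have h0 : Integrable (fun p : ℝ × ℝ => C * r p.2) (unitMeasure.prod unitMeasure) :=
      (hri.comp_snd _).const_mul C
    refine h0.mono (((measurable_triKernel L).aestronglyMeasurable.mul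
      (Continuous.aestronglyMeasurable (by fun_prop))).mul hr.aestronglyMeasurable.comp_snd) ?_
    have hmem : ∀ᵐ p ∂(unitMeasure.prod unitMeasure), p.1 ∈ Icc (0 : ℝ) 1 :=
      Measure.quasiMeasurePreserving_fst.ae (ae_restrict_mem measurableSet_Icc)
    have hmem' : ∀ᵐ p ∂(unitMeasure.prod unitMeasure), p.2 ∈ Icc (0 : ℝ) 1 :=
      Measure.quasiMeasurePreserving_snd.ae (ae_restrict_mem measurableSet_Icc)
    filter_upwards [hmem, hmem'] with p hp hp'
    rw [norm_mul, norm_mul, norm_mul]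
    gcongr
    rw [Real.norm_eq_abs, Real.norm_eq_abs, Real.norm_eq_abs]
    calc |triKernel L p.1 p.2| * |s p.1| ≤ |triKernel L p.1 p.2| * 1 := by gcongr; exact hs1 _
      _ ≤ |C| := by rw [mul_one]; exact (hC _ hp _ hp').trans (le_abs_self C)
  have hint : ∀ {f : ℝ → ℝ}, Integrable f unitMeasure →
      Integrable (fun y => f y * s y) unitMeasure := by
    intro f hf
    refine hf.mono (hf.aestronglyMeasurable.mul hs.aestronglyMeasurable)
      (Eventually.of_forall fun y => ?_)
    rw [norm_mul]
    exact mul_le_of_le_one_right (norm_nonneg _) (hs1 y)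
  have e1 : ∫ y, r y * adjointTransform L s y ∂unitMeasure
      = ∫ η, (r η * s η + ∫ y, triKernel L y η * s y * r η ∂unitMeasure) ∂unitMeasure := by
    refine integral_congr_ae ?_
    filter_upwards [ae_restrict_mem measurableSet_Icc] with η hη
    rw [adjointTransform_eq L s hη, integral_mul_const]
    ring
  have e2 : ∫ y, (r y + volterra L r y) * s y ∂unitMeasure
      = ∫ y, (r y * s y + ∫ η, triKernel L y η * s y * r η ∂unitMeasure) ∂unitMeasure := by
    refine integral_congr_ae (Eventually.of_forall fun y => ?_)
    simp only [volterra]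
    rw [add_mul, ← integral_mul_const]
    congr 2
    ext η
    ring
  rw [e1, e2, integral_add (hint hri) hprod.integral_prod_right,
    integral_add (hint hri) hprod.integral_prod_left]
  congr 1
  exact (integral_integral_swap hprod).symm

end Volterra

/-- The images of the Dirichlet modes under the adjoint backstepping transform. -/
def backMode (L : ℝ) (n : ℕ) : ℝ → ℝ := adjointTransform L (sineMode n)

/-- The family `backMode L` is a Riesz-type system: its coefficients control and are controlled by
the sine coefficients. -/
lemma exists_backMode_bounds (L : ℝ) : ∃ C : ℝ≥0, ∀ r : ℝ → ℝ, MemLp r 2 unitMeasure →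
    ∑' n, ‖∫ y, r y * backMode L n y ∂unitMeasure‖ₑ ^ 2
        ≤ C * ∑' n, ‖∫ y, r y * sineMode n y ∂unitMeasure‖ₑ ^ 2 ∧
    ∑' n, ‖∫ y, r y * sineMode n y ∂unitMeasure‖ₑ ^ 2
        ≤ C * ∑' n, ‖∫ y, r y * backMode L n y ∂unitMeasure‖ₑ ^ 2 := by
  obtain ⟨C, hC1, hC⟩ := exists_triKernel_bound L
  set K : ℝ := max (2 + 2 * C ^ 2) (4 * Real.exp (4 * C ^ 2)) with hK
  have hK0 : 0 ≤ K := le_max_of_le_left (by positivity)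
  refine ⟨K.toNNReal, fun r hr => ?_⟩
  have hb : ∀ n, ∫ y, r y * backMode L n y ∂unitMeasure
      = ∫ y, (r y + volterra L r y) * sineMode n y ∂unitMeasure := fun n =>
    integral_mul_adjointTransform hC hr (continuous_sineMode n) (abs_sineMode_le n)
  have h1 := tsum_enorm_sq_sineMode hr
  have h2 := tsum_enorm_sq_sineMode (hr.add (memLp_volterra hC hr))
  simp only [Pi.add_apply] at h2
  simp only [hb]
  set A := ∑' n, ‖∫ y, r y * sineMode n y ∂unitMeasure‖ₑ ^ 2
  set B := ∑' n, ‖∫ y, (r y + volterra L r y) * sineMode n y ∂unitMeasure‖ₑ ^ 2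
  have hR : 0 ≤ ∫ y, r y ^ 2 ∂unitMeasure := integral_nonneg fun y => sq_nonneg _
  have hW : 0 ≤ ∫ y, (r y + volterra L r y) ^ 2 ∂unitMeasure := integral_nonneg fun y => sq_nonneg _
  have cancel : ∀ a b : ℝ≥0∞, 2 * a ≤ K.toNNReal * (2 * b) → a ≤ K.toNNReal * b := by
    intro a b h
    rw [mul_left_comm] at h
    exact (ENNReal.mul_le_mul_iff_right (by norm_num) (by norm_num)).mp h
  constructor
  · apply cancel
    rw [h1, h2, show ((K.toNNReal : ℝ≥0) : ℝ≥0∞) = ENNReal.ofReal K from rfl,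
      ← ENNReal.ofReal_mul hK0]
    refine ENNReal.ofReal_le_ofReal ((integral_sq_transform_le hC hr).trans ?_)
    gcongr
    exact le_max_left _ _
  · apply cancel
    rw [h1, h2, show ((K.toNNReal : ℝ≥0) : ℝ≥0∞) = ENNReal.ofReal K from rfl,
      ← ENNReal.ofReal_mul hK0]
    refine ENNReal.ofReal_le_ofReal ((integral_sq_le_transform hC1 hC hr).trans ?_)
    gcongr
    exact le_max_right _ _

/-! ### Square-integrable functions of two variables and their slices -/

section SquareIntegrable

variable {α β : Type*} [MeasurableSpace α] [MeasurableSpace β] {μ : Measure α} {ν : Measure β}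

lemma sq_lintegral_mul_le {f g : α → ℝ≥0∞} (hf : AEMeasurable f μ) (hg : AEMeasurable g μ) :
    (∫⁻ x, f x * g x ∂μ) ^ 2 ≤ (∫⁻ x, f x ^ 2 ∂μ) * ∫⁻ x, g x ^ 2 ∂μ := by
  have h := ENNReal.lintegral_mul_le_Lp_mul_Lq μ Real.HolderConjugate.two_two hf hg
  simp only [Pi.mul_apply, ENNReal.rpow_ofNat] at h
  calc (∫⁻ x, f x * g x ∂μ) ^ 2
      ≤ ((∫⁻ x, f x ^ 2 ∂μ) ^ (1 / (2 : ℝ)) * (∫⁻ x, g x ^ 2 ∂μ) ^ (1 / (2 : ℝ))) ^ 2 := by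
        gcongr
    _ = _ := by
        rw [mul_pow, ← ENNReal.rpow_ofNat, ← ENNReal.rpow_ofNat, ← ENNReal.rpow_mul,
          ← ENNReal.rpow_mul]
        norm_num

lemma eLpNorm_two_sq {E : Type*} [NormedAddCommGroup E] (f : α → E) :
    eLpNorm f 2 μ ^ 2 = ∫⁻ x, ‖f x‖ₑ ^ 2 ∂μ := by
  have h := eLpNorm_nnreal_pow_eq_lintegral (μ := μ) (f := f) (p := 2) (by norm_num)
  simpa using h

lemma enorm_Lp_sq {E : Type*} [NormedAddCommGroup E] (f : Lp E 2 μ) :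
    ‖f‖ₑ ^ 2 = ∫⁻ x, ‖f x‖ₑ ^ 2 ∂μ := by
  rw [Lp.enorm_def, eLpNorm_two_sq]

lemma memLp_two_of_lintegral {f : α → ℝ} (hf : AEStronglyMeasurable f μ)
    (h : ∫⁻ x, ‖f x‖ₑ ^ 2 ∂μ < ⊤) : MemLp f 2 μ := by
  refine ⟨hf, ?_⟩
  rw [← eLpNorm_two_sq] at h
  by_contra hc
  rw [not_lt, top_le_iff] at hc
  simp [hc] at h

lemma lintegral_sq_lt_top {E : Type*} [NormedAddCommGroup E] {f : α → E} (hf : MemLp f 2 μ) :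
    ∫⁻ x, ‖f x‖ₑ ^ 2 ∂μ < ⊤ := by
  rw [← eLpNorm_two_sq]
  exact ENNReal.pow_lt_top hf.2

variable [SFinite ν]

lemma memLp_tensor [SFinite μ] {f : α → ℝ} {g : β → ℝ} (hf : MemLp f 2 μ) (hg : MemLp g 2 ν) :
    MemLp (fun p : α × β => f p.1 * g p.2) 2 (μ.prod ν) := by
  refine memLp_two_of_lintegral (hf.1.comp_fst.mul hg.1.comp_snd) ?_
  have := lintegral_prod_mul (μ := μ) (ν := ν) (f := fun x => ‖f x‖ₑ ^ 2)
    (g := fun x => ‖g x‖ₑ ^ 2) (hf.1.enorm.pow_const 2) (hg.1.enorm.pow_const 2)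
  simp only [enorm_mul, mul_pow]
  rw [this]
  exact ENNReal.mul_lt_top (lintegral_sq_lt_top hf) (lintegral_sq_lt_top hg)

variable {v : α × β → ℝ} {g : β → ℝ}

lemma aestronglyMeasurable_slice (hv : MemLp v 2 (μ.prod ν)) (hg : MemLp g 2 ν) :
    AEStronglyMeasurable (fun x => ∫ y, v (x, y) * g y ∂ν) μ :=
  AEStronglyMeasurable.integral_prod_right' (f := fun p : α × β => v p * g p.2)
    (hv.1.mul hg.1.comp_snd)

lemma lintegral_sq_slice_le (hv : MemLp v 2 (μ.prod ν)) (hg : MemLp g 2 ν) :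
    ∫⁻ x, ‖∫ y, v (x, y) * g y ∂ν‖ₑ ^ 2 ∂μ
      ≤ (∫⁻ p, ‖v p‖ₑ ^ 2 ∂(μ.prod ν)) * ∫⁻ y, ‖g y‖ₑ ^ 2 ∂ν := by
  rw [lintegral_prod _ (hv.1.enorm.pow_const 2), ← lintegral_mul_const'' _
    (hv.1.enorm.pow_const 2).lintegral_prod_right']
  refine lintegral_mono_ae ?_
  filter_upwards [hv.1.prodMk_left] with x hx
  refine le_trans ?_ (sq_lintegral_mul_le hx.enorm hg.1.enorm)
  gcongr
  refine (enorm_integral_le_lintegral_enorm _).trans_eq ?_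
  simp only [enorm_mul]

lemma memLp_slice (hv : MemLp v 2 (μ.prod ν)) (hg : MemLp g 2 ν) :
    MemLp (fun x => ∫ y, v (x, y) * g y ∂ν) 2 μ :=
  memLp_two_of_lintegral (aestronglyMeasurable_slice hv hg)
    ((lintegral_sq_slice_le hv hg).trans_lt
      (ENNReal.mul_lt_top (lintegral_sq_lt_top hv) (lintegral_sq_lt_top hg)))

lemma ae_memLp_prodMk (hv : MemLp v 2 (μ.prod ν)) : ∀ᵐ x ∂μ, MemLp (fun y => v (x, y)) 2 ν := by
  have h := lintegral_sq_lt_top hv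
  rw [lintegral_prod _ (hv.1.enorm.pow_const 2)] at h
  filter_upwards [hv.1.prodMk_left, ae_lt_top' (hv.1.enorm.pow_const 2).lintegral_prod_right' h.ne]
    with x hx hx'
  exact memLp_two_of_lintegral hx hx'

lemma integral_slice_mul [SFinite μ] (hv : MemLp v 2 (μ.prod ν)) (hg : MemLp g 2 ν) {a : α → ℝ}
    (ha : MemLp a 2 μ) :
    ∫ x, (∫ y, v (x, y) * g y ∂ν) * a x ∂μ = ∫ p, v p * (a p.1 * g p.2) ∂(μ.prod ν) := by
  rw [integral_prod (fun p => v p * (a p.1 * g p.2)) (hv.integrable_mul (memLp_tensor ha hg))]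
  congr 1
  ext x
  rw [← integral_mul_const]
  congr 1
  ext y
  ring

/-- Integrating in x first leaves a function of y alone, to which the one-dimensional bounds in y
apply. -/
lemma integral_slice_mul' [SFinite μ] (hv : MemLp v 2 (μ.prod ν)) (hg : MemLp g 2 ν) {a : α → ℝ}
    (ha : MemLp a 2 μ) :
    ∫ y, (∫ x, v (x, y) * a x ∂μ) * g y ∂ν = ∫ p, v p * (a p.1 * g p.2) ∂(μ.prod ν) := by
  rw [integral_prod_symm (fun p => v p * (a p.1 * g p.2))
    (hv.integrable_mul (memLp_tensor ha hg))]
  congr 1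
  ext x
  rw [← integral_mul_const]
  congr 1
  ext y
  ring

end SquareIntegrable

/-- Real square-integrable functions on the line. -/
abbrev LineL2 : Type := Lp ℝ 2 (volume : Measure ℝ)

/-- The partial pairing `v ↦ ∫_0^1 v(·, y) ψ(y) dy` as a bounded operator. -/
def slice (ψ : ℝ → ℝ) (hψ : MemLp ψ 2 unitMeasure) : StripL2 →L[ℝ] LineL2 :=
  LinearMap.mkContinuous
    { toFun := fun v => (memLp_slice (Lp.memLp v) hψ).toLp
      map_add' := fun v w => by
        rw [← MemLp.toLp_add]
        refine MemLp.toLp_congr _ _ ?_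
        filter_upwards [Measure.ae_ae_of_ae_prod (Lp.coeFn_add v w), ae_memLp_prodMk (Lp.memLp v),
          ae_memLp_prodMk (Lp.memLp w)] with x hx hv hw
        simp only [Pi.add_apply]
        have i1 : Integrable (fun y => v (x, y) * ψ y) unitMeasure := hv.integrable_mul hψ
        have i2 : Integrable (fun y => w (x, y) * ψ y) unitMeasure := hw.integrable_mul hψ
        rw [← integral_add i1 i2]
        refine integral_congr_ae ?_
        filter_upwards [hx] with y hy
        rw [hy]
        simp only [Pi.add_apply]
        ring
      map_smul' := fun c v => by
        rw [RingHom.id_apply, ← MemLp.toLp_const_smul]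
        refine MemLp.toLp_congr _ _ ?_
        filter_upwards [Measure.ae_ae_of_ae_prod (Lp.coeFn_smul c v)] with x hx
        simp only [Pi.smul_apply]
        rw [← integral_smul]
        refine integral_congr_ae ?_
        filter_upwards [hx] with y hy
        rw [hy]
        simp only [Pi.smul_apply, smul_eq_mul]
        ring }
    ‖hψ.toLp‖ (fun v => by
      have h := lintegral_sq_slice_le (Lp.memLp v) hψ
      have e1 : ‖(memLp_slice (Lp.memLp v) hψ).toLp‖ₑ ^ 2 ≤ (‖hψ.toLp‖ₑ * ‖v‖ₑ) ^ 2 := by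
        rw [mul_pow, Lp.enorm_toLp, eLpNorm_two_sq, Lp.enorm_toLp, eLpNorm_two_sq, enorm_Lp_sq,
          mul_comm]
        exact h
      have e2 := (ENNReal.pow_le_pow_left_iff two_ne_zero).mp e1
      rw [← enorm_norm, ← enorm_norm hψ.toLp, ← enorm_norm v, ← enorm_mul] at e2
      have e3 := ENNReal.toReal_mono enorm_ne_top e2
      rw [toReal_enorm, toReal_enorm] at e3
      simpa using e3)

lemma coeFn_slice {ψ : ℝ → ℝ} (hψ : MemLp ψ 2 unitMeasure) (v : StripL2) :
    slice ψ hψ v =ᵐ[volume] fun x => ∫ y, v (x, y) * ψ y ∂unitMeasure :=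
  (memLp_slice (Lp.memLp v) hψ).coeFn_toLp

lemma inner_slice {ψ : ℝ → ℝ} (hψ : MemLp ψ 2 unitMeasure) (v : StripL2) (g : LineL2) :
    ⟪g, slice ψ hψ v⟫ = ∫ p, v p * (g p.1 * ψ p.2) ∂stripMeasure := by
  rw [L2.inner_def, ← integral_slice_mul (Lp.memLp v) hψ (Lp.memLp g)]
  refine integral_congr_ae ?_
  filter_upwards [coeFn_slice hψ v] with x hx
  simp [hx]

lemma inner_slice' {ψ : ℝ → ℝ} (hψ : MemLp ψ 2 unitMeasure) (v : StripL2) (g : LineL2) :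
    ⟪g, slice ψ hψ v⟫ = ∫ y, (∫ x, v (x, y) * g x) * ψ y ∂unitMeasure := by
  rw [inner_slice, integral_slice_mul' (Lp.memLp v) hψ (Lp.memLp g)]

lemma memLp_slice_fst (v : StripL2) (g : LineL2) :
    MemLp (fun y => ∫ x, v (x, y) * g x) 2 unitMeasure := by
  have h : MemLp (fun p : ℝ × ℝ => v p.swap) 2 (unitMeasure.prod volume) :=
    (Lp.memLp v).comp_measurePreserving Measure.measurePreserving_swap
  exact memLp_slice h (Lp.memLp g)

lemma memLp_of_continuous {ψ : ℝ → ℝ} (hψ : Continuous ψ) : MemLp ψ 2 unitMeasure := by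
  obtain ⟨C, hC⟩ := (isCompact_Icc (a := (0 : ℝ)) (b := 1)).exists_bound_of_continuousOn
    hψ.continuousOn
  refine MemLp.of_bound hψ.aestronglyMeasurable C ?_
  filter_upwards [ae_restrict_mem measurableSet_Icc] with y hy using hC y hy

lemma memLp_sineMode (n : ℕ) : MemLp (sineMode n) 2 unitMeasure :=
  memLp_of_continuous (continuous_sineMode n)

lemma continuous_backMode (L : ℝ) (n : ℕ) : Continuous (backMode L n) :=
  (contDiff_adjointTransform (hasDerivAt_sineMode n) (hasDerivAt_sineModeDeriv n)
    (sineMode_one n)).continuous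

lemma memLp_backMode (L : ℝ) (n : ℕ) : MemLp (backMode L n) 2 unitMeasure :=
  memLp_of_continuous (continuous_backMode L n)

lemma tsum_enorm_sq_slice {ψ : ℕ → ℝ → ℝ} (hψ : ∀ n, MemLp (ψ n) 2 unitMeasure) (v : StripL2) :
    ∑' n, ‖slice (ψ n) (hψ n) v‖ₑ ^ 2
      = ∫⁻ x, ∑' n, ‖∫ y, v (x, y) * ψ n y ∂unitMeasure‖ₑ ^ 2 := by
  rw [lintegral_tsum fun n =>
    (aestronglyMeasurable_slice (Lp.memLp v) (hψ n)).enorm.pow_const 2]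
  congr 1
  ext n
  rw [enorm_Lp_sq]
  refine lintegral_congr_ae ?_
  filter_upwards [coeFn_slice (hψ n) v] with x hx
  rw [hx]

/-- Parseval's identity in the transversal variable. -/
lemma two_mul_tsum_enorm_sq_slice_sineMode (v : StripL2) :
    2 * ∑' n, ‖slice (sineMode n) (memLp_sineMode n) v‖ₑ ^ 2 = ‖v‖ₑ ^ 2 := by
  rw [tsum_enorm_sq_slice, enorm_Lp_sq, lintegral_prod _ ((Lp.memLp v).1.enorm.pow_const 2),
    ← lintegral_const_mul' _ _ (by norm_num)]
  refine lintegral_congr_ae ?_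
  filter_upwards [ae_memLp_prodMk (Lp.memLp v)] with x hx
  rw [tsum_enorm_sq_sineMode hx,
    ofReal_integral_eq_lintegral_ofReal hx.integrable_sq (Eventually.of_forall fun y => sq_nonneg _)]
  simp only [enorm_sq_eq_ofReal]

/-- Parseval's identity for a Hilbert basis, with values in `ℝ≥0∞`. -/
lemma enorm_sq_eq_tsum_inner {ι E : Type*} [NormedAddCommGroup E] [InnerProductSpace ℝ E]
    (b : HilbertBasis ι ℝ E) (x : E) : ‖x‖ₑ ^ 2 = ∑' i, ‖⟪b i, x⟫‖ₑ ^ 2 := by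
  have h := b.hasSum_inner_mul_inner x x
  have h' : HasSum (fun i => ⟪b i, x⟫ ^ 2) (‖x‖ ^ 2) := by
    rw [← real_inner_self_eq_norm_sq]
    refine h.congr_fun fun i => ?_
    rw [real_inner_comm x (b i)]
    ring
  simp only [enorm_sq_eq_ofReal]
  rw [← ENNReal.ofReal_tsum_of_nonneg (fun i => sq_nonneg _) h'.summable, h'.tsum_eq,
    ← enorm_norm, enorm_sq_eq_ofReal]

/-- Equivalence of the sine and of the backstepping coefficients, after applying a bounded operator
to the longitudinal variable. -/
lemma tsum_enorm_sq_slice_le {E : Type*} [NormedAddCommGroup E] [InnerProductSpace ℝ E]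
    [CompleteSpace E] (P : LineL2 →L[ℝ] E) {ψ χ : ℕ → ℝ → ℝ}
    (hψ : ∀ n, MemLp (ψ n) 2 unitMeasure) (hχ : ∀ n, MemLp (χ n) 2 unitMeasure) {C : ℝ≥0∞}
    (hC : ∀ r : ℝ → ℝ, MemLp r 2 unitMeasure →
      ∑' n, ‖∫ y, r y * ψ n y ∂unitMeasure‖ₑ ^ 2
        ≤ C * ∑' n, ‖∫ y, r y * χ n y ∂unitMeasure‖ₑ ^ 2) (v : StripL2) :
    ∑' n, ‖P (slice (ψ n) (hψ n) v)‖ₑ ^ 2 ≤ C * ∑' n, ‖P (slice (χ n) (hχ n) v)‖ₑ ^ 2 := by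
  -- Against a fixed basis vector b i, the vectors P (slice ρ_n v) have as components the
  -- coefficients of the scalar function y ↦ ∫ v(x,y) (P* b i)(x) dx, the same function for ψ and χ.
  -- The scalar inequality applies for each i, and summing over i restores the norms.
  obtain ⟨w, b, -⟩ := exists_hilbertBasis ℝ E
  have key : ∀ {ρ : ℕ → ℝ → ℝ} (hρ : ∀ n, MemLp (ρ n) 2 unitMeasure),
      ∑' n, ‖P (slice (ρ n) (hρ n) v)‖ₑ ^ 2 = ∑' i, ∑' n,
        ‖∫ y, (∫ x, v (x, y) * (ContinuousLinearMap.adjoint P (b i)) x) * ρ n y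
          ∂unitMeasure‖ₑ ^ 2 := by
    intro ρ hρ
    rw [ENNReal.tsum_comm]
    congr 1
    ext n
    rw [enorm_sq_eq_tsum_inner b]
    congr 1
    ext i
    rw [← ContinuousLinearMap.adjoint_inner_left, inner_slice']
  rw [key hψ, key hχ, ← ENNReal.tsum_mul_left]
  exact ENNReal.tsum_le_tsum fun i => hC _ (memLp_slice_fst v _)

/-! ### The feedback law as a bounded functional -/

/-- The ideal low-pass kernel `2 N sinc (2 π N z)`. -/
def lowPass (N : ℕ) (z : ℝ) : ℝ := 2 * (N : ℝ) * Real.sinc (2 * Real.pi * (N : ℝ) * z)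

lemma continuous_lowPass (N : ℕ) : Continuous (lowPass N) := by
  unfold lowPass
  exact continuous_const.mul (Real.continuous_sinc.comp (by fun_prop))

/-- Add sinc² ≤ 1 and z² sinc² ≤ 1. The low-pass kernel is not absolutely integrable for N ≥ 1, but
this decay puts it in L², which is enough against L² states. -/
lemma sq_sinc_le (z : ℝ) : Real.sinc z ^ 2 ≤ 2 * (1 + z ^ 2)⁻¹ := by
  have h1 : Real.sinc z ^ 2 ≤ 1 := by
    rw [← sq_abs]
    exact pow_le_one₀ (abs_nonneg _) (Real.abs_sinc_le_one z)
  have h2 : z ^ 2 * Real.sinc z ^ 2 ≤ 1 := by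
    by_cases hz : z = 0
    · simp [hz]
    · rw [Real.sinc_of_ne_zero hz, div_pow, mul_div_cancel₀ _ (pow_ne_zero 2 hz)]
      exact Real.sin_sq_le_one z
  rw [← div_eq_mul_inv, le_div_iff₀ (by positivity)]
  nlinarith

lemma memLp_lowPass (N : ℕ) : MemLp (lowPass N) 2 volume := by
  rcases Nat.eq_zero_or_pos N with rfl | hN
  · have : lowPass 0 = fun _ => 0 := by ext z; simp [lowPass]
    rw [this]
    exact MemLp.zero'
  rw [memLp_two_iff_integrable_sq (continuous_lowPass N).aestronglyMeasurable]
  have hN' : (0 : ℝ) < N := by exact_mod_cast hN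
  have hR : 2 * Real.pi * (N : ℝ) ≠ 0 := by positivity
  have h0 := ((integrable_inv_one_add_sq.const_mul 2).comp_mul_left' hR).const_mul
    ((2 * (N : ℝ)) ^ 2)
  refine h0.mono ((continuous_lowPass N).pow 2).aestronglyMeasurable
    (Eventually.of_forall fun z => ?_)
  rw [Real.norm_of_nonneg (sq_nonneg _), Real.norm_of_nonneg (by positivity), lowPass, mul_pow]
  exact mul_le_mul_of_nonneg_left (sq_sinc_le _) (by positivity)

lemma memLp_lowPass_sub (N : ℕ) (x : ℝ) : MemLp (fun ξ => lowPass N (x - ξ)) 2 volume :=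
  (memLp_lowPass N).comp_measurePreserving (Measure.measurePreserving_sub_left volume x)

/-- The translates of the low-pass kernel as elements of `L²`. -/
def lowPassLp (N : ℕ) (x : ℝ) : LineL2 := (memLp_lowPass_sub N x).toLp

lemma norm_lowPassLp (N : ℕ) (x : ℝ) : ‖lowPassLp N x‖ = ‖lowPassLp N 0‖ := by
  have h : ∀ x, eLpNorm (fun ξ => lowPass N (x - ξ)) 2 volume = eLpNorm (lowPass N) 2 volume :=
    fun x => eLpNorm_comp_measurePreserving (memLp_lowPass N).1
      (Measure.measurePreserving_sub_left volume x)
  rw [lowPassLp, lowPassLp, Lp.norm_toLp, Lp.norm_toLp, h, h]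

lemma inner_toLp {a : ℝ → ℝ} (ha : MemLp a 2 volume) (w : LineL2) :
    ⟪ha.toLp, w⟫ = ∫ x, w x * a x := by
  rw [L2.inner_def]
  refine integral_congr_ae ?_
  filter_upwards [ha.coeFn_toLp] with x hx
  simp [hx]

section Feedback

variable (ε lam c : ℝ) (N : ℕ)

lemma continuous_gain : Continuous (gain ε lam c) := by
  have h := (contDiff_besselClifford 1).continuous
  have : gain ε lam c = fun η => lambda0 ε lam c * η *
      (besselClifford 1 (Real.sqrt (lambda0 ε lam c * (1 - η ^ 2)) ^ 2 / 4) / 2) := by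
    ext η
    rw [gain, besselQuot_eq]
  rw [this]
  fun_prop

lemma memLp_gain : MemLp (gain ε lam c) 2 unitMeasure := memLp_of_continuous (continuous_gain ε lam c)

/-- Pairing with the gain in η first exhibits the feedback as minus the convolution of one L²
function of ξ with the filter kernel. -/
lemma truncatedFeedback_eq_integral (v : StripL2) (x : ℝ) :
    truncatedFeedback ε lam c N v x
      = -∫ ξ, slice (gain ε lam c) (memLp_gain ε lam c) v ξ * lowPass N (x - ξ) := by
  rw [truncatedFeedback, ← integral_unitMeasure]
  congr 1
  have h := integral_slice_mul' (Lp.memLp v) (memLp_gain ε lam c) (memLp_lowPass_sub N x)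
  rw [← integral_slice_mul (Lp.memLp v) (memLp_gain ε lam c) (memLp_lowPass_sub N x)] at h
  have e1 : ∫ ξ, slice (gain ε lam c) (memLp_gain ε lam c) v ξ * lowPass N (x - ξ)
      = ∫ ξ, (∫ η, v (ξ, η) * gain ε lam c η ∂unitMeasure) * lowPass N (x - ξ) := by
    refine integral_congr_ae ?_
    filter_upwards [coeFn_slice (memLp_gain ε lam c) v] with ξ hξ
    rw [hξ]
  rw [e1, ← h]
  congr 1
  ext η
  rw [← integral_mul_const]
  congr 1
  ext ξ
  rw [truncatedKernel, lowPass]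
  ring

lemma truncatedFeedback_eq_inner (v : StripL2) (x : ℝ) :
    truncatedFeedback ε lam c N v x
      = -⟪lowPassLp N x, slice (gain ε lam c) (memLp_gain ε lam c) v⟫ := by
  rw [truncatedFeedback_eq_integral, lowPassLp, inner_toLp]

/-- Translation preserves the L² norm of the kernel, so the bound is uniform in x and the feedback
can be paired with any integrable function. -/
lemma abs_truncatedFeedback_le (v : StripL2) (x : ℝ) :
    |truncatedFeedback ε lam c N v x|
      ≤ ‖lowPassLp N 0‖ * ‖slice (gain ε lam c) (memLp_gain ε lam c)‖ * ‖v‖ := by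
  rw [truncatedFeedback_eq_inner, abs_neg, mul_assoc, ← norm_lowPassLp N x]
  exact (abs_real_inner_le_norm _ _).trans
    (mul_le_mul_of_nonneg_left (ContinuousLinearMap.le_opNorm _ _) (norm_nonneg _))

lemma aestronglyMeasurable_truncatedFeedback (v : StripL2) :
    AEStronglyMeasurable (truncatedFeedback ε lam c N v) volume := by
  have h := AEStronglyMeasurable.integral_prod_right' (μ := (volume : Measure ℝ))
    (ν := (volume : Measure ℝ)) (f := fun p : ℝ × ℝ =>
      slice (gain ε lam c) (memLp_gain ε lam c) v p.2 * lowPass N (p.1 - p.2))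
    ((Lp.aestronglyMeasurable _).comp_snd.mul
      ((continuous_lowPass N).comp (by fun_prop)).aestronglyMeasurable)
  refine h.neg.congr (Eventually.of_forall fun x => ?_)
  rw [truncatedFeedback_eq_integral]
  rfl

lemma integrable_truncatedFeedback_mul (v : StripL2) {a : ℝ → ℝ} (ha : Integrable a) :
    Integrable fun x => truncatedFeedback ε lam c N v x * a x :=
  ha.bdd_mul (aestronglyMeasurable_truncatedFeedback ε lam c N v)
    (Eventually.of_forall (abs_truncatedFeedback_le ε lam c N v))

/-- The pairing `v ↦ ∫ U_N(x) a(x) dx` of the feedback with an integrable function. -/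
def feedbackPairing {a : ℝ → ℝ} (ha : Integrable a) : StripL2 →L[ℝ] ℝ :=
  LinearMap.mkContinuous
    { toFun := fun v => ∫ x, truncatedFeedback ε lam c N v x * a x
      map_add' := fun v w => by
        rw [← integral_add (integrable_truncatedFeedback_mul ε lam c N v ha)
          (integrable_truncatedFeedback_mul ε lam c N w ha)]
        congr 1
        ext x
        simp only [truncatedFeedback_eq_inner, map_add, inner_add_right]
        ring
      map_smul' := fun k v => by
        rw [RingHom.id_apply, smul_eq_mul, ← integral_const_mul]
        congr 1
        ext x
        simp only [truncatedFeedback_eq_inner, map_smul, inner_smul_right]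
        ring }
    (‖lowPassLp N 0‖ * ‖slice (gain ε lam c) (memLp_gain ε lam c)‖ * ∫ x, |a x|) (fun v => by
      simp only [LinearMap.coe_mk, AddHom.coe_mk]
      refine (norm_integral_le_integral_norm _).trans ?_
      calc ∫ x, ‖truncatedFeedback ε lam c N v x * a x‖
          ≤ ∫ x, (‖lowPassLp N 0‖ * ‖slice (gain ε lam c) (memLp_gain ε lam c)‖ * ‖v‖) * |a x| := by
            refine integral_mono (integrable_truncatedFeedback_mul ε lam c N v ha).norm
              (ha.abs.const_mul _) fun x => ?_
            simp only [norm_mul, Real.norm_eq_abs]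
            exact mul_le_mul_of_nonneg_right (abs_truncatedFeedback_le ε lam c N v x)
              (abs_nonneg _)
        _ = _ := by rw [integral_const_mul]; ring)

lemma feedbackPairing_apply {a : ℝ → ℝ} (ha : Integrable a) (v : StripL2) :
    feedbackPairing ε lam c N ha v = ∫ x, truncatedFeedback ε lam c N v x * a x := rfl

end Feedback

/-! ### The weak formulation for product test functions -/

/-- The transversal factor `ε ψ'' + λ ψ` produced by the differential operator. -/
def transversal (ε lam : ℝ) (ψ : ℝ → ℝ) (y : ℝ) : ℝ := ε * deriv (deriv ψ) y + lam * ψ y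

lemma continuous_transversal (ε lam : ℝ) {ψ : ℝ → ℝ} (hψ : ContDiff ℝ ∞ ψ) :
    Continuous (transversal ε lam ψ) := by
  have h1 : ContDiff ℝ ∞ (deriv ψ) := (contDiff_infty_iff_deriv.mp hψ).2
  have h2 : ContDiff ℝ ∞ (deriv (deriv ψ)) := (contDiff_infty_iff_deriv.mp h1).2
  have := hψ.continuous
  have := h2.continuous
  unfold transversal
  fun_prop

/-- A smooth cutoff equal to one near the unit interval. -/
def transversalBump : ContDiffBump (1 / 2 : ℝ) := ⟨1, 2, by norm_num, by norm_num⟩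

/-- The transversal profiles have no compact support in y. A cutoff equal to one near every point of
[0,1] supplies it without changing derivatives in the strip or on its boundary. -/
lemma transversalBump_eventually {y : ℝ} (hy : y ∈ Icc (0 : ℝ) 1) :
    transversalBump =ᶠ[𝓝 y] 1 := by
  apply transversalBump.eventuallyEq_one_of_mem_ball
  rw [Metric.mem_ball, Real.dist_eq, abs_lt]
  simp only [transversalBump]
  constructor <;> linarith [hy.1, hy.2]

/-- Product test functions `a(x) ψ(y)`, cut off away from the strip. -/
def productTest (a ψ : ℝ → ℝ) (p : ℝ × ℝ) : ℝ := a p.1 * (transversalBump p.2 * ψ p.2)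

section ProductTest

variable {a ψ : ℝ → ℝ}

lemma isTestFunction_productTest (ha : ContDiff ℝ ∞ a) (hac : HasCompactSupport a)
    (hψ : ContDiff ℝ ∞ ψ) (h0 : ψ 0 = 0) (h1 : ψ 1 = 0) : IsTestFunction (productTest a ψ) where
  smooth := by
    have hb : ContDiff ℝ ∞ transversalBump := transversalBump.contDiff
    exact (ha.comp contDiff_fst).mul ((hb.comp contDiff_snd).mul (hψ.comp contDiff_snd))
  compactSupport := by
    refine HasCompactSupport.intro (hac.isCompact.prod transversalBump.hasCompactSupport.isCompact)
      fun p hp => ?_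
    rw [productTest]
    by_cases h : p.1 ∈ tsupport a
    · rw [image_eq_zero_of_notMem_tsupport (f := transversalBump) (x := p.2) fun h' => hp ⟨h, h'⟩]
      simp
    · rw [image_eq_zero_of_notMem_tsupport h]
      simp
  bottom x := by simp [productTest, h0]
  top x := by simp [productTest, h1]

lemma productTest_eventually (x : ℝ) {y : ℝ} (hy : y ∈ Icc (0 : ℝ) 1) :
    (fun y => productTest a ψ (x, y)) =ᶠ[𝓝 y] fun y => a x * ψ y := by
  filter_upwards [transversalBump_eventually hy] with z hz
  simp [productTest, hz]

lemma productTest_eq (x : ℝ) {y : ℝ} (hy : y ∈ Icc (0 : ℝ) 1) :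
    productTest a ψ (x, y) = a x * ψ y := (productTest_eventually x hy).self_of_nhds

lemma reactionDiffusion_productTest (ε lam : ℝ) (x : ℝ) {y : ℝ} (hy : y ∈ Icc (0 : ℝ) 1) :
    reactionDiffusion ε lam (productTest a ψ) (x, y)
      = ε * (deriv (deriv a) x * ψ y) + a x * transversal ε lam ψ y := by
  have e1 : (fun x : ℝ => productTest a ψ (x, y)) = fun x => a x * ψ y :=
    funext fun x => productTest_eq x hy
  have e2 := (productTest_eventually (a := a) (ψ := ψ) x hy).iteratedDeriv_eq 2
  rw [reactionDiffusion]
  simp only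
  rw [e1, e2, productTest_eq x hy, iteratedDeriv_succ, iteratedDeriv_one, iteratedDeriv_succ,
    iteratedDeriv_one, transversal]
  have d1 : deriv (fun x => a x * ψ y) = fun x => deriv a x * ψ y :=
    funext fun x => deriv_mul_const_field _
  have d2 : deriv (fun y => a x * ψ y) = fun y => a x * deriv ψ y :=
    funext fun x => deriv_const_mul_field _
  rw [d1, d2, deriv_mul_const_field, deriv_const_mul_field]
  ring

lemma deriv_productTest (x : ℝ) :
    deriv (fun y => productTest a ψ (x, y)) 1 = a x * deriv ψ 1 := by
  rw [(productTest_eventually x ⟨zero_le_one, le_rfl⟩).deriv_eq]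
  exact deriv_const_mul_field _

end ProductTest

lemma ae_stripMeasure_mem : ∀ᵐ p ∂stripMeasure, p.2 ∈ Icc (0 : ℝ) 1 :=
  Measure.quasiMeasurePreserving_snd.ae (ae_restrict_mem measurableSet_Icc)

/-- The generator of the weak formulation tested against `a(x) ψ(y)`, as a bounded functional of the
state; `b` stands for `a''`. -/
def generator (ε lam c : ℝ) (N : ℕ) {a b ψ : ℝ → ℝ} (ha : Integrable a) (ha2 : MemLp a 2 volume)
    (hb2 : MemLp b 2 volume) (hψ : ContDiff ℝ ∞ ψ) : StripL2 →L[ℝ] ℝ :=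
  ε • (innerSL ℝ hb2.toLp ∘L slice ψ (memLp_of_continuous hψ.continuous))
    + innerSL ℝ ha2.toLp ∘L slice (transversal ε lam ψ)
        (memLp_of_continuous (continuous_transversal ε lam hψ))
    - (ε * deriv ψ 1) • feedbackPairing ε lam c N ha

lemma generator_apply (ε lam c : ℝ) (N : ℕ) {a b ψ : ℝ → ℝ} (ha : Integrable a)
    (ha2 : MemLp a 2 volume) (hb2 : MemLp b 2 volume) (hψ : ContDiff ℝ ∞ ψ) (v : StripL2) :
    generator ε lam c N ha ha2 hb2 hψ v
      = ε * (∫ x, slice ψ (memLp_of_continuous hψ.continuous) v x * b x)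
        + (∫ x, slice (transversal ε lam ψ)
            (memLp_of_continuous (continuous_transversal ε lam hψ)) v x * a x)
        - ε * deriv ψ 1 * ∫ x, truncatedFeedback ε lam c N v x * a x := by
  simp [generator, inner_toLp, feedbackPairing_apply]

section WeakForm

variable {ε lam c : ℝ} {N : ℕ} {u : ℝ → StripL2}

lemma IsClosedLoopSolution.weak_product (h : IsClosedLoopSolution ε lam c N u) {a ψ : ℝ → ℝ}
    (hac : ContDiff ℝ ∞ a) (hacs : HasCompactSupport a) (ha : Integrable a)
    (ha2 : MemLp a 2 volume) (hb2 : MemLp (deriv (deriv a)) 2 volume)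
    (hψ : ContDiff ℝ ∞ ψ) (h0 : ψ 0 = 0) (h1 : ψ 1 = 0) {t : ℝ} (ht : 0 ≤ t) :
    ∫ x, slice ψ (memLp_of_continuous hψ.continuous) (u t) x * a x
      = (∫ x, slice ψ (memLp_of_continuous hψ.continuous) (u 0) x * a x)
        + ∫ s in (0 : ℝ)..t, generator ε lam c N ha ha2 hb2 hψ (u s) := by
  have hψ2 := memLp_of_continuous hψ.continuous
  have hρ2 := memLp_of_continuous (continuous_transversal ε lam hψ)
  have h := h.weak _ (isTestFunction_productTest hac hacs hψ h0 h1) t ht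
  have e1 : ∀ v : StripL2, ∫ p, v p * productTest a ψ p ∂stripMeasure
      = ∫ x, slice ψ hψ2 v x * a x := by
    intro v
    rw [← inner_toLp ha2, inner_slice]
    refine integral_congr_ae ?_
    have hc := Measure.quasiMeasurePreserving_fst (μ := (volume : Measure ℝ))
      (ν := unitMeasure) |>.ae ha2.coeFn_toLp
    filter_upwards [ae_stripMeasure_mem, hc] with p hp hp'
    rw [hp', productTest_eq p.1 hp]
  have e2 : ∀ v : StripL2, (∫ p, v p * reactionDiffusion ε lam (productTest a ψ) p ∂stripMeasure)
      - ε * ∫ x, truncatedFeedback ε lam c N v x * deriv (fun y => productTest a ψ (x, y)) 1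
      = generator ε lam c N ha ha2 hb2 hψ v := by
    intro v
    rw [generator_apply, ← inner_toLp ha2, ← inner_toLp hb2, inner_slice, inner_slice]
    have hc := Measure.quasiMeasurePreserving_fst (μ := (volume : Measure ℝ))
      (ν := unitMeasure) |>.ae ha2.coeFn_toLp
    have hc' := Measure.quasiMeasurePreserving_fst (μ := (volume : Measure ℝ))
      (ν := unitMeasure) |>.ae hb2.coeFn_toLp
    congr 1
    · rw [← integral_const_mul, ← integral_add]
      · refine integral_congr_ae ?_
        filter_upwards [ae_stripMeasure_mem, hc, hc'] with p hp hp' hp''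
        rw [hp', hp'', reactionDiffusion_productTest ε lam p.1 hp]
        ring
      · exact ((Lp.memLp v).integrable_mul (memLp_tensor (Lp.memLp _) hψ2)).const_mul ε
      · exact (Lp.memLp v).integrable_mul (memLp_tensor (Lp.memLp _) hρ2)
    · simp only [deriv_productTest]
      rw [mul_assoc, ← integral_const_mul (deriv ψ 1)]
      congr 2
      ext x
      ring
  simp only [e1, e2] at h
  exact h

end WeakForm

/-! ### Extension of the weak formulation to Schwartz functions -/

/-- A fixed smooth cutoff of the line. -/
def lineBump : ContDiffBump (0 : ℝ) := ⟨1, 2, by norm_num, by norm_num⟩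

/-- Smooth compactly supported truncations of a function on the line. -/
def truncate (a : ℝ → ℝ) (n : ℕ) (x : ℝ) : ℝ := lineBump (x / (n + 1)) * a x

section Truncate

variable {a : ℝ → ℝ}

lemma contDiff_lineBump : ContDiff ℝ ∞ (lineBump : ℝ → ℝ) := lineBump.contDiff

lemma contDiff_truncate (ha : ContDiff ℝ ∞ a) (n : ℕ) : ContDiff ℝ ∞ (truncate a n) :=
  (contDiff_lineBump.comp (contDiff_id.div_const _)).mul ha

lemma hasCompactSupport_truncate (n : ℕ) : HasCompactSupport (truncate a n) := by
  refine HasCompactSupport.intro (isCompact_closedBall (0 : ℝ) (2 * (n + 1))) fun x hx => ?_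
  have hn : (0 : ℝ) < n + 1 := by positivity
  rw [Metric.mem_closedBall, dist_zero_right, not_le, Real.norm_eq_abs] at hx
  have : lineBump (x / (n + 1)) = 0 := by
    refine lineBump.zero_of_le_dist ?_
    rw [dist_zero_right, Real.norm_eq_abs, abs_div, abs_of_pos hn, le_div_iff₀ hn]
    exact hx.le
  rw [truncate, this, zero_mul]

lemma abs_truncate_le (n : ℕ) (x : ℝ) : |truncate a n x| ≤ |a x| := by
  rw [truncate, abs_mul, abs_of_nonneg lineBump.nonneg]
  exact mul_le_of_le_one_left (abs_nonneg _) lineBump.le_one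

lemma truncate_eventuallyEq (x : ℝ) : ∀ᶠ n : ℕ in atTop, truncate a n =ᶠ[𝓝 x] a := by
  obtain ⟨m, hm⟩ := exists_nat_gt |x|
  filter_upwards [eventually_ge_atTop m] with n hn
  have hn0 : (0 : ℝ) < n + 1 := by positivity
  have hmn : (m : ℝ) ≤ n := by exact_mod_cast hn
  have hx : |x| < (n : ℝ) + 1 := by linarith
  filter_upwards [continuous_abs.continuousAt.eventually_lt continuousAt_const hx] with z hz
  have : lineBump (z / (n + 1)) = 1 := by
    refine lineBump.one_of_mem_closedBall ?_
    rw [Metric.mem_closedBall, dist_zero_right, Real.norm_eq_abs, abs_div, abs_of_pos hn0,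
      div_le_iff₀ hn0]
    simpa [lineBump] using hz.le
  rw [truncate, this, one_mul]

lemma tendsto_truncate (x : ℝ) : Tendsto (fun n => truncate a n x) atTop (𝓝 (a x)) :=
  tendsto_nhds_of_eventually_eq ((truncate_eventuallyEq x).mono fun _ h => h.self_of_nhds)

lemma tendsto_deriv_deriv_truncate (x : ℝ) :
    Tendsto (fun n => deriv (deriv (truncate a n)) x) atTop (𝓝 (deriv (deriv a) x)) :=
  tendsto_nhds_of_eventually_eq
    ((truncate_eventuallyEq x).mono fun _ h => h.deriv.deriv_eq)

/-- Each derivative falling on the rescaled cutoff brings a factor 1/(n + 1) ≤ 1. So K is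
independent of n, and the right-hand side can serve as a dominating function. -/
lemma exists_deriv_deriv_truncate_bound : ∃ K : ℝ, ∀ a : ℝ → ℝ, ContDiff ℝ ∞ a → ∀ n x,
    |deriv (deriv (truncate a n)) x| ≤ K * (|a x| + |deriv a x| + |deriv (deriv a) x|) := by
  have hB := contDiff_lineBump
  have hB1 : ContDiff ℝ ∞ (deriv lineBump) := (contDiff_infty_iff_deriv.mp hB).2
  have hB2 : ContDiff ℝ ∞ (deriv (deriv lineBump)) := (contDiff_infty_iff_deriv.mp hB1).2
  have hc1 : HasCompactSupport (deriv lineBump) := lineBump.hasCompactSupport.deriv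
  have hc2 : HasCompactSupport (deriv (deriv lineBump)) := hc1.deriv
  obtain ⟨K1, hK1⟩ := hc1.exists_bound_of_continuous hB1.continuous
  obtain ⟨K2, hK2⟩ := hc2.exists_bound_of_continuous hB2.continuous
  have hK1' : 0 ≤ K1 := (norm_nonneg _).trans (hK1 0)
  have hK2' : 0 ≤ K2 := (norm_nonneg _).trans (hK2 0)
  refine ⟨1 + 2 * K1 + K2, fun a ha n x => ?_⟩
  have ha1 : ContDiff ℝ ∞ (deriv a) := (contDiff_infty_iff_deriv.mp ha).2
  have hd : ∀ {f : ℝ → ℝ}, ContDiff ℝ ∞ f → ∀ x, HasDerivAt f (deriv f x) x := fun hf x =>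
    ((contDiff_infty_iff_deriv.mp hf).1 x).hasDerivAt
  set R : ℝ := (n : ℝ) + 1 with hR
  have hR1 : 1 ≤ R := by rw [hR]; linarith [Nat.cast_nonneg (α := ℝ) n]
  have hcomp : ∀ {f : ℝ → ℝ}, ContDiff ℝ ∞ f → ∀ x,
      HasDerivAt (fun x => f (x / R)) (deriv f (x / R) * (1 / R)) x := fun hf x =>
    (hd hf (x / R)).comp x ((hasDerivAt_id x).div_const R)
  have e1 : deriv (truncate a n) = fun x =>
      deriv lineBump (x / R) * (1 / R) * a x + lineBump (x / R) * deriv a x :=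
    funext fun x => ((hcomp hB x).mul (hd ha x)).deriv
  have e2 : deriv (deriv (truncate a n)) x
      = (deriv (deriv lineBump) (x / R) * (1 / R) * (1 / R) * a x
          + deriv lineBump (x / R) * (1 / R) * deriv a x)
        + (deriv lineBump (x / R) * (1 / R) * deriv a x
          + lineBump (x / R) * deriv (deriv a) x) := by
    rw [e1]
    exact ((((hcomp hB1 x).mul_const (1 / R)).mul (hd ha x)).add
      ((hcomp hB x).mul (hd ha1 x))).deriv
  have hRi : |1 / R| ≤ 1 := by
    rw [abs_of_pos (by positivity)]
    exact (div_le_one (by positivity)).mpr hR1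
  have b1 : |deriv (deriv lineBump) (x / R) * (1 / R) * (1 / R)| ≤ K2 := by
    rw [abs_mul, abs_mul]
    calc _ ≤ K2 * 1 * 1 := by gcongr; exact hK2 _
      _ = K2 := by ring
  have b2 : |deriv lineBump (x / R) * (1 / R)| ≤ K1 := by
    rw [abs_mul]
    calc _ ≤ K1 * 1 := by gcongr; exact hK1 _
      _ = K1 := by ring
  have b3 : |lineBump (x / R)| ≤ 1 := by
    rw [abs_of_nonneg lineBump.nonneg]; exact lineBump.le_one
  rw [e2]
  have t1 := abs_add_le (deriv (deriv lineBump) (x / R) * (1 / R) * (1 / R) * a x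
          + deriv lineBump (x / R) * (1 / R) * deriv a x)
          (deriv lineBump (x / R) * (1 / R) * deriv a x
          + lineBump (x / R) * deriv (deriv a) x)
  have t2 := abs_add_le (deriv (deriv lineBump) (x / R) * (1 / R) * (1 / R) * a x)
    (deriv lineBump (x / R) * (1 / R) * deriv a x)
  have t3 := abs_add_le (deriv lineBump (x / R) * (1 / R) * deriv a x)
    (lineBump (x / R) * deriv (deriv a) x)
  rw [abs_mul _ (a x), abs_mul _ (deriv a x)] at t2
  rw [abs_mul _ (deriv a x), abs_mul _ (deriv (deriv a) x)] at t3
  have s1 := mul_le_mul_of_nonneg_right b1 (abs_nonneg (a x))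
  have s2 := mul_le_mul_of_nonneg_right b2 (abs_nonneg (deriv a x))
  have s3 := mul_le_mul_of_nonneg_right b3 (abs_nonneg (deriv (deriv a) x))
  have p1 := mul_nonneg hK1' (abs_nonneg (a x))
  have p2 := mul_nonneg hK2' (abs_nonneg (deriv a x))
  have p3 := mul_nonneg hK1' (abs_nonneg (deriv (deriv a) x))
  have p4 := mul_nonneg hK2' (abs_nonneg (deriv (deriv a) x))
  nlinarith [abs_nonneg (a x), abs_nonneg (deriv a x), abs_nonneg (deriv (deriv a) x)]

end Truncate

/-- The second derivative of a Schwartz function. -/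
def secondDeriv (a : 𝓢(ℝ, ℝ)) : 𝓢(ℝ, ℝ) :=
  SchwartzMap.derivCLM ℝ ℝ (SchwartzMap.derivCLM ℝ ℝ a)

lemma coe_derivCLM (a : 𝓢(ℝ, ℝ)) : ⇑(SchwartzMap.derivCLM ℝ ℝ a) = deriv a :=
  funext fun x => SchwartzMap.derivCLM_apply ℝ a x

lemma coe_secondDeriv (a : 𝓢(ℝ, ℝ)) : ⇑(secondDeriv a) = deriv (deriv a) := by
  rw [secondDeriv, coe_derivCLM, coe_derivCLM]

section WeakForm

variable {ε lam c : ℝ} {N : ℕ} {u : ℝ → StripL2}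

/-- The weak formulation tested against `a(x) ψ(y)` with a Schwartz function `a`. -/
lemma IsClosedLoopSolution.weak_schwartz (h : IsClosedLoopSolution ε lam c N u) (a : 𝓢(ℝ, ℝ))
    {ψ : ℝ → ℝ} (hψ : ContDiff ℝ ∞ ψ) (h0 : ψ 0 = 0) (h1 : ψ 1 = 0) {t : ℝ} (ht : 0 ≤ t) :
    ∫ x, slice ψ (memLp_of_continuous hψ.continuous) (u t) x * a x
      = (∫ x, slice ψ (memLp_of_continuous hψ.continuous) (u 0) x * a x)
        + ∫ s in (0 : ℝ)..t, generator ε lam c N a.integrable (a.memLp 2)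
            ((secondDeriv a).memLp 2) hψ (u s) := by
  obtain ⟨K, hK⟩ := exists_deriv_deriv_truncate_bound
  have hac : ContDiff ℝ ∞ a := a.smooth ⊤
  have hAc : ∀ n, ContDiff ℝ ∞ (truncate a n) := contDiff_truncate hac
  have hA2c : ∀ n, Continuous (deriv (deriv (truncate a n))) := fun n =>
    (contDiff_infty_iff_deriv.mp (contDiff_infty_iff_deriv.mp (hAc n)).2).2.continuous
  have hAs : ∀ n, HasCompactSupport (truncate a n) := fun n => hasCompactSupport_truncate n
  have hAi : ∀ n, Integrable (truncate a n) := fun n =>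
    (hAc n).continuous.integrable_of_hasCompactSupport (hAs n)
  have hA2 : ∀ n, MemLp (truncate a n) 2 volume := fun n =>
    (hAc n).continuous.memLp_of_hasCompactSupport (hAs n)
  have hA22 : ∀ n, MemLp (deriv (deriv (truncate a n))) 2 volume := fun n =>
    (hA2c n).memLp_of_hasCompactSupport (hAs n).deriv.deriv
  have ha0 : MemLp (fun x => |a x|) 2 volume :=
    (a.memLp 2 (volume : Measure ℝ)).abs
  have ha1 : MemLp (fun x => |deriv a x|) 2 volume := by
    have := ((SchwartzMap.derivCLM ℝ ℝ a).memLp 2 (volume : Measure ℝ)).abs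
    rwa [coe_derivCLM] at this
  have ha2 : MemLp (fun x => |deriv (deriv a) x|) 2 volume := by
    have := ((secondDeriv a).memLp 2 (volume : Measure ℝ)).abs
    rwa [coe_secondDeriv] at this
  have lim0 : ∀ w : LineL2, Tendsto (fun n => ∫ x, w x * truncate a n x) atTop
      (𝓝 (∫ x, w x * a x)) := by
    intro w
    refine tendsto_integral_of_dominated_convergence (fun x => |w x| * |a x|)
      (fun n => (Lp.aestronglyMeasurable w).mul (hA2 n).1)
      ((Lp.memLp w).abs.integrable_mul ha0) (fun n => Eventually.of_forall fun x => ?_)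
      (Eventually.of_forall fun x => (tendsto_truncate x).const_mul _)
    rw [norm_mul]
    exact mul_le_mul_of_nonneg_left (abs_truncate_le n x) (norm_nonneg _)
  have lim2 : ∀ w : LineL2, Tendsto (fun n => ∫ x, w x * deriv (deriv (truncate a n)) x) atTop
      (𝓝 (∫ x, w x * secondDeriv a x)) := by
    intro w
    rw [coe_secondDeriv]
    refine tendsto_integral_of_dominated_convergence
      (fun x => |w x| * (K * (|a x| + |deriv a x| + |deriv (deriv a) x|)))
      (fun n => (Lp.aestronglyMeasurable w).mul (hA22 n).1)
      ((Lp.memLp w).abs.integrable_mul (((ha0.add ha1).add ha2).const_mul K))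
      (fun n => Eventually.of_forall fun x => ?_)
      (Eventually.of_forall fun x => (tendsto_deriv_deriv_truncate x).const_mul _)
    rw [norm_mul]
    exact mul_le_mul_of_nonneg_left (hK a hac n x) (norm_nonneg _)
  have limF : ∀ v : StripL2, Tendsto (fun n => ∫ x, truncatedFeedback ε lam c N v x * truncate a n x)
      atTop (𝓝 (∫ x, truncatedFeedback ε lam c N v x * a x)) := by
    intro v
    refine tendsto_integral_of_dominated_convergence
      (fun x => |truncatedFeedback ε lam c N v x * a x|)
      (fun n => (integrable_truncatedFeedback_mul ε lam c N v (hAi n)).1)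
      (integrable_truncatedFeedback_mul ε lam c N v a.integrable).abs
      (fun n => Eventually.of_forall fun x => ?_)
      (Eventually.of_forall fun x => (tendsto_truncate x).const_mul _)
    rw [norm_mul, abs_mul]
    exact mul_le_mul_of_nonneg_left (abs_truncate_le n x) (norm_nonneg _)
  have limG : ∀ v : StripL2, Tendsto
      (fun n => generator ε lam c N (hAi n) (hA2 n) (hA22 n) hψ v) atTop
      (𝓝 (generator ε lam c N a.integrable (a.memLp 2) ((secondDeriv a).memLp 2) hψ v)) := by
    intro v
    simp only [generator_apply]
    exact (((lim2 _).const_mul ε).add (lim0 _)).sub ((limF v).const_mul _)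
  -- Pointwise convergence of the functionals bounds their norms uniformly. With the bound of u on
  -- [0,t] this dominates the time integrals.
  obtain ⟨C, hC⟩ := banach_steinhaus
    (g := fun n => generator ε lam c N (hAi n) (hA2 n) (hA22 n) hψ) fun v => by
      obtain ⟨C, hC⟩ := (limG v).norm.bddAbove_range
      exact ⟨C, fun n => hC ⟨n, rfl⟩⟩
  have hcont : ContinuousOn u (uIcc 0 t) := by
    rw [uIcc_of_le ht]
    exact h.continuous.mono Icc_subset_Ici_self
  obtain ⟨U, hU⟩ := isCompact_uIcc.exists_bound_of_continuousOn hcont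
  have limI : Tendsto (fun n => ∫ s in (0 : ℝ)..t,
      generator ε lam c N (hAi n) (hA2 n) (hA22 n) hψ (u s)) atTop
      (𝓝 (∫ s in (0 : ℝ)..t, generator ε lam c N a.integrable (a.memLp 2)
            ((secondDeriv a).memLp 2) hψ (u s))) := by
    refine intervalIntegral.tendsto_integral_filter_of_dominated_convergence (fun _ => C * U)
      (Eventually.of_forall fun n => ?_) (Eventually.of_forall fun n =>
        Eventually.of_forall fun s hs => ?_) (by simp)
      (Eventually.of_forall fun s _ => limG (u s))
    · exact (((generator ε lam c N (hAi n) (hA2 n) (hA22 n) hψ).continuous.comp_continuousOn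
        hcont).mono uIoc_subset_uIcc).aestronglyMeasurable measurableSet_uIoc
    · exact (ContinuousLinearMap.le_opNorm _ _).trans (mul_le_mul (hC n)
        (hU s (uIoc_subset_uIcc hs)) (norm_nonneg _) ((norm_nonneg _).trans (hC n)))
  have lhs := lim0 (slice ψ (memLp_of_continuous hψ.continuous) (u t))
  have rhs := (lim0 (slice ψ (memLp_of_continuous hψ.continuous) (u 0))).add limI
  refine tendsto_nhds_unique lhs (rhs.congr fun n => ?_)
  exact (h.weak_product (hAc n) (hAs n) (hAi n) (hA2 n) (hA22 n) hψ h0 h1 ht).symm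

end WeakForm

/-! ### The feedback on band-limited test functions -/

/-- The real part of the Fourier transform of a Schwartz function. -/
def reFourier (b : 𝓢(ℝ, ℂ)) : 𝓢(ℝ, ℝ) := SchwartzMap.postcompCLM (𝕜 := ℝ) Complex.reCLM (𝓕 b)

lemma reFourier_apply (b : 𝓢(ℝ, ℂ)) (x : ℝ) : reFourier b x = ((𝓕 b : 𝓢(ℝ, ℂ)) x).re := rfl

/-- The kernel is the Fourier integral of the indicator of [-N,N]: this is why the truncation is a
sharp frequency cutoff. -/
lemma lowPass_eq_integral (N : ℕ) (z : ℝ) :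
    (lowPass N z : ℂ) = ∫ k in (-N : ℝ)..N, Complex.exp ((2 * Real.pi * k * z : ℝ) * Complex.I) := by
  by_cases hz : z = 0
  · subst hz
    simp [lowPass]
    ring
  · have hc : (2 * Real.pi * z : ℂ) * Complex.I ≠ 0 := by
      simp [hz, Real.pi_ne_zero]
    have e : ∀ k : ℝ, Complex.exp ((2 * Real.pi * k * z : ℝ) * Complex.I)
        = Complex.exp (((2 * Real.pi * z : ℂ) * Complex.I) * k) := by
      intro k; congr 1; push_cast; ring
    simp only [e]
    rw [integral_exp_mul_complex hc, lowPass]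
    by_cases hN : (N : ℝ) = 0
    · simp [hN]
    have hne : 2 * Real.pi * (N : ℝ) * z ≠ 0 := by
      have := Real.pi_ne_zero
      positivity
    rw [Real.sinc_of_ne_zero hne]
    push_cast
    rw [Complex.sin]
    have hπ : (Real.pi : ℂ) ≠ 0 := by exact_mod_cast Real.pi_ne_zero
    have hz' : (z : ℂ) ≠ 0 := by exact_mod_cast hz
    have hN' : (N : ℂ) ≠ 0 := by exact_mod_cast hN
    have hI := Complex.I_ne_zero
    rw [show -(2 * (Real.pi : ℂ) * N * z) * Complex.I = 2 * Real.pi * z * Complex.I * -N by ring,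
      show 2 * (Real.pi : ℂ) * N * z * Complex.I = 2 * Real.pi * z * Complex.I * N by ring]
    field_simp
    rw [Complex.I_sq]
    ring

/-- Fubini over the bounded band, then Fourier inversion for b. Only the values of b on the band
remain. -/
lemma integral_fourier_mul_lowPass (b : 𝓢(ℝ, ℂ)) (N : ℕ) (ξ : ℝ) :
    ∫ x, (𝓕 b : 𝓢(ℝ, ℂ)) x * (lowPass N (x - ξ) : ℂ)
      = ∫ k in (-N : ℝ)..N, Complex.exp (-(2 * Real.pi * k * ξ : ℝ) * Complex.I) * b k := by
  have hN : (-N : ℝ) ≤ N := by linarith [Nat.cast_nonneg (α := ℝ) N]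
  simp only [lowPass_eq_integral, intervalIntegral.integral_of_le hN, ← integral_const_mul]
  have hint : Integrable (fun p : ℝ × ℝ => (𝓕 b : 𝓢(ℝ, ℂ)) p.1 *
      Complex.exp ((2 * Real.pi * p.2 * (p.1 - ξ) : ℝ) * Complex.I))
      ((volume : Measure ℝ).prod (volume.restrict (Ioc (-N : ℝ) N))) := by
    have h0 : Integrable (fun p : ℝ × ℝ => (𝓕 b : 𝓢(ℝ, ℂ)) p.1)
        ((volume : Measure ℝ).prod (volume.restrict (Ioc (-N : ℝ) N))) :=
      (𝓕 b : 𝓢(ℝ, ℂ)).integrable.comp_fst _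
    refine h0.mono (h0.1.mul (Continuous.aestronglyMeasurable (by fun_prop)))
      (Eventually.of_forall fun p => ?_)
    rw [norm_mul, Complex.norm_exp_ofReal_mul_I, mul_one]
  rw [integral_integral_swap hint]
  congr 1
  ext k
  have hinv : b k = 𝓕⁻ ((𝓕 b : 𝓢(ℝ, ℂ)) : ℝ → ℂ) k := by
    rw [← SchwartzMap.fourierInv_coe]
    simp
  rw [hinv, Real.fourierInv_eq', ← integral_const_mul]
  congr 1
  ext x
  rw [smul_eq_mul, mul_comm, ← mul_assoc, ← Complex.exp_add]
  congr 2
  simp only [inner]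
  push_cast
  simp
  ring

lemma memLp_lowPass_sub' (N : ℕ) (ξ : ℝ) : MemLp (fun x => (lowPass N (x - ξ) : ℂ)) 2 volume :=
  ((memLp_lowPass N).comp_measurePreserving (measurePreserving_sub_right volume ξ)).ofReal

/-- The low-pass filter reproduces functions with spectrum in the band. -/
lemma integral_reFourier_mul_lowPass_of_low {b : 𝓢(ℝ, ℂ)} {N : ℕ}
    (hb : ∀ k : ℝ, (N : ℝ) ≤ |k| → b k = 0) (ξ : ℝ) :
    ∫ x, reFourier b x * lowPass N (x - ξ) = reFourier b ξ := by
  have hN : (-N : ℝ) ≤ N := by linarith [Nat.cast_nonneg (α := ℝ) N]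
  have h := integral_fourier_mul_lowPass b N ξ
  have e : ∫ k in (-N : ℝ)..N, Complex.exp (-(2 * Real.pi * k * ξ : ℝ) * Complex.I) * b k
      = (𝓕 b : 𝓢(ℝ, ℂ)) ξ := by
    rw [intervalIntegral.integral_of_le hN, setIntegral_eq_integral_of_forall_compl_eq_zero]
    · rw [SchwartzMap.fourier_coe, Real.fourier_eq']
      congr 1
      ext k
      rw [smul_eq_mul]
      congr 2
      simp
      ring
    · intro k hk
      rw [hb k, mul_zero]
      by_contra hc
      rw [not_le, abs_lt] at hc
      exact hk ⟨hc.1, hc.2.le⟩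
  rw [e] at h
  rw [reFourier_apply, ← h, ← RCLike.re_eq_complex_re, ← integral_re]
  · simp [reFourier_apply]
  · exact ((𝓕 b : 𝓢(ℝ, ℂ)).memLp 2).integrable_mul (memLp_lowPass_sub' N ξ)

/-- The low-pass filter annihilates functions with spectrum outside the band. -/
lemma integral_reFourier_mul_lowPass_of_high {b : 𝓢(ℝ, ℂ)} {N : ℕ}
    (hb : ∀ k : ℝ, |k| ≤ (N : ℝ) → b k = 0) (ξ : ℝ) :
    ∫ x, reFourier b x * lowPass N (x - ξ) = 0 := by
  have hN : (-N : ℝ) ≤ N := by linarith [Nat.cast_nonneg (α := ℝ) N]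
  have h := integral_fourier_mul_lowPass b N ξ
  have e : ∫ k in (-N : ℝ)..N, Complex.exp (-(2 * Real.pi * k * ξ : ℝ) * Complex.I) * b k = 0 := by
    rw [intervalIntegral.integral_of_le hN]
    refine setIntegral_eq_zero_of_forall_eq_zero fun k hk => ?_
    rw [hb k (abs_le.mpr ⟨hk.1.le, hk.2⟩), mul_zero]
  rw [e] at h
  have h' := congrArg Complex.re h
  rw [Complex.zero_re, ← RCLike.re_eq_complex_re, ← integral_re] at h'
  · simpa [reFourier_apply] using h'
  · exact ((𝓕 b : 𝓢(ℝ, ℂ)).memLp 2).integrable_mul (memLp_lowPass_sub' N ξ)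

section Feedback

variable (ε lam c : ℝ) (N : ℕ)

/-- Fubini moves the filter from the state, whose spectrum is arbitrary, to the test function, whose
spectrum can be prescribed. Integrability comes from a ∈ L¹ and Cauchy–Schwarz in ξ, uniformly in x.
-/
lemma integral_truncatedFeedback_mul (v : StripL2) (a : 𝓢(ℝ, ℝ)) :
    ∫ x, truncatedFeedback ε lam c N v x * a x
      = -∫ ξ, slice (gain ε lam c) (memLp_gain ε lam c) v ξ *
          ∫ x, a x * lowPass N (x - ξ) := by
  set w := slice (gain ε lam c) (memLp_gain ε lam c) v with hw
  have hm : AEStronglyMeasurable (fun p : ℝ × ℝ => w p.2 * (a p.1 * lowPass N (p.1 - p.2)))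
      ((volume : Measure ℝ).prod volume) :=
    (Lp.aestronglyMeasurable w).comp_snd.mul ((a.continuous.comp continuous_fst).mul
      ((continuous_lowPass N).comp (by fun_prop))).aestronglyMeasurable
  have hi : ∀ x, Integrable fun ξ => w ξ * lowPass N (x - ξ) := fun x =>
    (Lp.memLp w).integrable_mul (memLp_lowPass_sub N x)
  have hint : Integrable (fun p : ℝ × ℝ => w p.2 * (a p.1 * lowPass N (p.1 - p.2)))
      ((volume : Measure ℝ).prod volume) := by
    rw [integrable_prod_iff hm]
    refine ⟨Eventually.of_forall fun x => ?_, ?_⟩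
    · exact ((hi x).const_mul (a x)).congr (Eventually.of_forall fun ξ => by simp only; ring)
    · refine (a.integrable.abs.mul_const (‖lowPassLp N 0‖ * ‖w‖)).mono hm.norm.integral_prod_right'
        (Eventually.of_forall fun x => ?_)
      rw [Real.norm_of_nonneg (integral_nonneg fun _ => norm_nonneg _),
        Real.norm_of_nonneg (by positivity)]
      have e : ∫ ξ, ‖w ξ * (a x * lowPass N (x - ξ))‖ = |a x| * ∫ ξ, |w ξ| * |lowPass N (x - ξ)| := by
        rw [← integral_const_mul]
        congr 1
        ext ξ
        simp only [norm_mul, Real.norm_eq_abs]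
        ring
      have hb : ∫ ξ, |w ξ| * |lowPass N (x - ξ)| ≤ ‖lowPassLp N 0‖ * ‖w‖ := by
        have h1 : MemLp (fun ξ => |w ξ|) 2 volume := (Lp.memLp w).abs
        have h2 : MemLp (fun ξ => |lowPass N (x - ξ)|) 2 volume := (memLp_lowPass_sub N x).abs
        have h3 : ∫ ξ, |w ξ| * |lowPass N (x - ξ)| = ⟪h2.toLp, h1.toLp⟫ := by
          rw [inner_toLp]
          refine integral_congr_ae ?_
          filter_upwards [h1.coeFn_toLp] with ξ hξ
          rw [hξ]
        rw [h3]
        refine (real_inner_le_norm _ _).trans_eq ?_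
        rw [← norm_lowPassLp N x, lowPassLp]
        congr 1
        · rw [Lp.norm_toLp, Lp.norm_toLp]
          congr 1
          exact eLpNorm_norm (fun ξ => lowPass N (x - ξ))
        · rw [Lp.norm_toLp, Lp.norm_def]
          congr 1
          exact eLpNorm_norm (fun ξ => w ξ)
      simp only
      rw [e]
      exact mul_le_mul_of_nonneg_left hb (abs_nonneg _)
  have h1 : ∫ x, truncatedFeedback ε lam c N v x * a x
      = -∫ x, ∫ ξ, w ξ * (a x * lowPass N (x - ξ)) := by
    rw [← integral_neg]
    congr 1
    ext x
    rw [truncatedFeedback_eq_integral, neg_mul, ← integral_mul_const]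
    congr 2
    ext ξ
    ring
  rw [h1, integral_integral_swap hint]
  congr 2
  ext ξ
  rw [integral_const_mul]

end Feedback

/-! ### Fourier multipliers and the decay of localized modes -/

/-- Complex square-integrable functions on the line, seen as a real Hilbert space. -/
abbrev FreqL2 : Type := Lp ℂ 2 (volume : Measure ℝ)

lemma real_inner_eq_re (f g : FreqL2) : ⟪f, g⟫ = (inner ℂ f g).re := by
  rw [L2.inner_def, L2.inner_def, ← RCLike.re_eq_complex_re, ← integral_re (L2.integrable_inner f g)]
  rfl

/-- The (inverse) Fourier transform of a real square-integrable function. -/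
def freq : LineL2 →L[ℝ] FreqL2 :=
  ((Lp.fourierTransformₗᵢ ℝ ℂ).symm.toContinuousLinearEquiv.toContinuousLinearMap.restrictScalars ℝ)
    ∘L Complex.ofRealCLM.compLpL 2 volume

lemma freq_apply (w : LineL2) : freq w =
    (Lp.fourierTransformₗᵢ ℝ ℂ).symm (Complex.ofRealCLM.compLpL 2 volume w) := rfl

lemma coeFn_ofReal_compLpL (w : LineL2) :
    (Complex.ofRealCLM.compLpL 2 volume w : FreqL2) =ᵐ[volume] fun x => (w x : ℂ) :=
  Complex.ofRealCLM.coeFn_compLpL w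

lemma enorm_freq_sq (w : LineL2) : ‖freq w‖ₑ ^ 2 = ‖w‖ₑ ^ 2 := by
  have : ‖freq w‖ₑ = ‖(Complex.ofRealCLM.compLpL 2 volume w : FreqL2)‖ₑ := by
    rw [freq_apply, ← enorm_norm, LinearIsometryEquiv.norm_map, enorm_norm]
  rw [this, enorm_Lp_sq, enorm_Lp_sq]
  refine lintegral_congr_ae ?_
  filter_upwards [coeFn_ofReal_compLpL w] with x hx
  rw [hx, ← enorm_norm, Complex.norm_real, enorm_norm]

/-- Unitarity moves the transform from w to b, and only the real part of 𝓕 b remains because w is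
real. The functions `reFourier b` are thus real test functions probing the frequencies in the
support of b. -/
lemma inner_freq (b : 𝓢(ℝ, ℂ)) (w : LineL2) :
    ⟪b.toLp 2, freq w⟫ = ∫ x, w x * reFourier b x := by
  have h1 : inner ℂ (b.toLp 2 : FreqL2) (freq w)
      = inner ℂ ((𝓕 b : 𝓢(ℝ, ℂ)).toLp 2) (Complex.ofRealCLM.compLpL 2 volume w : FreqL2) := by
    rw [freq_apply, ← SchwartzMap.toLp_fourier_eq]
    exact ((Lp.fourierTransformₗᵢ ℝ ℂ).inner_map_eq_flip _ _).symm
  rw [real_inner_eq_re, h1, L2.inner_def, ← RCLike.re_eq_complex_re,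
    ← integral_re (L2.integrable_inner _ _)]
  refine integral_congr_ae ?_
  filter_upwards [coeFn_ofReal_compLpL w, (𝓕 b : 𝓢(ℝ, ℂ)).coeFn_toLp 2 volume] with x h2 h3
  rw [h2, h3, reFourier_apply]
  simp

/-- Multiplication by a smooth compactly supported function. -/
def mulOp {θ : ℝ → ℝ} (hθ : Continuous θ) (hc : HasCompactSupport θ) : FreqL2 →L[ℝ] FreqL2 :=
  (ContinuousLinearMap.lsmul ℝ ℝ : ℝ →L[ℝ] ℂ →L[ℝ] ℂ).holderL volume ⊤ 2 2
    (hθ.memLp_of_hasCompactSupport (p := ⊤) hc).toLp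

lemma coeFn_mulOp {θ : ℝ → ℝ} (hθ : Continuous θ) (hc : HasCompactSupport θ) (f : FreqL2) :
    mulOp hθ hc f =ᵐ[volume] fun k => θ k • f k := by
  have h1 := (ContinuousLinearMap.lsmul ℝ ℝ : ℝ →L[ℝ] ℂ →L[ℝ] ℂ).coeFn_holder (r := 2)
    (hθ.memLp_of_hasCompactSupport (μ := volume) (p := ⊤) hc).toLp f
  filter_upwards [h1, (hθ.memLp_of_hasCompactSupport (μ := volume) (p := ⊤) hc).coeFn_toLp]
    with k h2 h3
  refine h2.trans ?_
  rw [h3]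
  rfl

/-- The product of a smooth compactly supported function and a Schwartz function. -/
def localize {θ : ℝ → ℝ} (hθ : ContDiff ℝ ∞ θ) (hc : HasCompactSupport θ) (ψ : 𝓢(ℝ, ℂ)) :
    𝓢(ℝ, ℂ) :=
  HasCompactSupport.toSchwartzMap (f := fun k => θ k • ψ k) hc.smul_right (hθ.smul (ψ.smooth ⊤))

lemma localize_apply {θ : ℝ → ℝ} (hθ : ContDiff ℝ ∞ θ) (hc : HasCompactSupport θ) (ψ : 𝓢(ℝ, ℂ))
    (k : ℝ) : localize hθ hc ψ k = θ k • ψ k := rfl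

lemma inner_mulOp_freq {θ : ℝ → ℝ} (hθ : ContDiff ℝ ∞ θ) (hc : HasCompactSupport θ)
    (ψ : 𝓢(ℝ, ℂ)) (w : LineL2) :
    ⟪ψ.toLp 2, mulOp hθ.continuous hc (freq w)⟫ = ∫ x, w x * reFourier (localize hθ hc ψ) x := by
  rw [← inner_freq, L2.inner_def, L2.inner_def]
  refine integral_congr_ae ?_
  filter_upwards [coeFn_mulOp hθ.continuous hc (freq w), ψ.coeFn_toLp 2 volume,
    (localize hθ hc ψ).coeFn_toLp 2 volume] with k h1 h2 h3
  rw [h1, h2, h3, localize_apply, inner_smul_left, inner_smul_right]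
  rfl

lemma deriv_fourier_of_hasCompactSupport {β : ℝ → ℂ} (hβ : Continuous β)
    (hc : HasCompactSupport β) :
    deriv (𝓕 β) = 𝓕 fun k : ℝ => (-2 * Real.pi * Complex.I * k) * β k := by
  have h : Continuous fun k : ℝ => k • β k := by fun_prop
  have h2 : HasCompactSupport fun k : ℝ => k • β k := hc.smul_left (f := fun k : ℝ => k)
  have h3 : Integrable fun k : ℝ => k • β k := h.integrable_of_hasCompactSupport h2
  rw [Real.deriv_fourier (hβ.integrable_of_hasCompactSupport hc) h3]
  rfl

lemma deriv_deriv_fourier {β : ℝ → ℂ} (hβ : Continuous β) (hc : HasCompactSupport β) :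
    deriv (deriv (𝓕 β)) = 𝓕 fun k : ℝ => (-(4 * Real.pi ^ 2 * k ^ 2) : ℝ) • β k := by
  have h : Continuous fun k : ℝ => (-2 * Real.pi * Complex.I * k) * β k := by fun_prop
  rw [deriv_fourier_of_hasCompactSupport hβ hc, deriv_fourier_of_hasCompactSupport h hc.mul_left]
  refine congrArg _ (funext fun k => ?_)
  simp only [Complex.real_smul]
  push_cast
  linear_combination (4 * (Real.pi : ℂ) ^ 2 * k ^ 2 * β k) * Complex.I_sq

lemma secondDeriv_reFourier (b : 𝓢(ℝ, ℂ)) (hc : HasCompactSupport b) (x : ℝ) :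
    secondDeriv (reFourier b) x
      = (𝓕 (fun k : ℝ => (-(4 * Real.pi ^ 2 * k ^ 2) : ℝ) • b k) x).re := by
  have hd : ∀ (f : 𝓢(ℝ, ℂ)), deriv (fun x => (f x).re) = fun x => (deriv f x).re := fun f =>
    funext fun x => (Complex.reCLM.hasFDerivAt.comp_hasDerivAt x (f.hasDerivAt x)).deriv
  rw [coe_secondDeriv, ← deriv_deriv_fourier b.continuous hc]
  have e : ⇑(reFourier b) = fun x => ((𝓕 b : 𝓢(ℝ, ℂ)) x).re := rfl
  have e2 : deriv ((𝓕 b : 𝓢(ℝ, ℂ)) : ℝ → ℂ) = (SchwartzMap.derivCLM ℝ ℂ (𝓕 b : 𝓢(ℝ, ℂ))) :=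
    funext fun x => (SchwartzMap.derivCLM_apply ℝ _ x).symm
  rw [e, hd, e2, hd, ← e2, SchwartzMap.fourier_coe]

/-- The symbol `μ - 4 π² ε k²`, localized by `θ`. -/
def localSymbol (ε μ : ℝ) (θ : ℝ → ℝ) (k : ℝ) : ℝ := (μ - 4 * Real.pi ^ 2 * ε * k ^ 2) * θ k

section Symbol

variable {ε μ : ℝ} {θ : ℝ → ℝ}

lemma contDiff_localSymbol (hθ : ContDiff ℝ ∞ θ) : ContDiff ℝ ∞ (localSymbol ε μ θ) := by
  unfold localSymbol; fun_prop

lemma hasCompactSupport_localSymbol (hc : HasCompactSupport θ) :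
    HasCompactSupport (localSymbol ε μ θ) := hc.mul_left

/-- On the Fourier side ε∂_x² + μ multiplies by μ - 4π²εk². The compact support of θ makes this a
bounded operator, so the evolution of a localized mode has a bounded generator. -/
lemma reFourier_localSymbol (hθ : ContDiff ℝ ∞ θ) (hc : HasCompactSupport θ) (ψ : 𝓢(ℝ, ℂ))
    (x : ℝ) :
    reFourier (localize (contDiff_localSymbol (ε := ε) (μ := μ) hθ)
        (hasCompactSupport_localSymbol hc) ψ) x
      = ε * secondDeriv (reFourier (localize hθ hc ψ)) x + μ * reFourier (localize hθ hc ψ) x := by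
  set b := localize hθ hc ψ with hb
  have hbc : HasCompactSupport b := hc.smul_right
  have i1 : Integrable b := b.integrable
  have i2 : Integrable fun k : ℝ => (-(4 * Real.pi ^ 2 * k ^ 2) : ℝ) • b k :=
    ((by fun_prop : Continuous fun k : ℝ => (-(4 * Real.pi ^ 2 * k ^ 2) : ℝ)).smul
      b.continuous).integrable_of_hasCompactSupport hbc.smul_left
  have e : ∀ k, localize (contDiff_localSymbol (ε := ε) (μ := μ) hθ)
      (hasCompactSupport_localSymbol hc) ψ k
      = (ε : ℂ) • ((-(4 * Real.pi ^ 2 * k ^ 2) : ℝ) • b k) + (μ : ℂ) • b k := by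
    intro k
    rw [hb, localize_apply, localize_apply, localSymbol]
    simp only [smul_eq_mul, Complex.real_smul]
    push_cast
    ring
  rw [secondDeriv_reFourier b hbc, reFourier_apply, reFourier_apply, SchwartzMap.fourier_coe,
    SchwartzMap.fourier_coe, funext e]
  have hadd : 𝓕 (fun k => (ε : ℂ) • ((-(4 * Real.pi ^ 2 * k ^ 2) : ℝ) • b k) + (μ : ℂ) • b k) x
      = (ε : ℂ) * 𝓕 (fun k : ℝ => (-(4 * Real.pi ^ 2 * k ^ 2) : ℝ) • b k) x
        + (μ : ℂ) * 𝓕 (b : ℝ → ℂ) x := by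
    simp only [Real.fourier_eq]
    rw [← integral_const_mul, ← integral_const_mul, ← integral_add]
    · congr 1
      ext k
      simp only [Circle.smul_def, smul_eq_mul]
      ring
    · exact ((Real.fourierIntegral_convergent_iff x).mpr i2).const_mul _
    · exact ((Real.fourierIntegral_convergent_iff x).mpr i1).const_mul _
  rw [hadd, Complex.add_re, Complex.re_ofReal_mul, Complex.re_ofReal_mul]

end Symbol

/-- Exponential decay from a dissipative integral equation in a Hilbert space. -/
lemma norm_le_exp_of_integral_eq {E : Type*} [NormedAddCommGroup E] [InnerProductSpace ℝ E]
    [CompleteSpace E] {f g : ℝ → E} {c : ℝ} (hg : ContinuousOn g (Ici 0))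
    (hfg : ∀ t, 0 ≤ t → f t = f 0 + ∫ s in (0 : ℝ)..t, g s)
    (hd : ∀ t, 0 ≤ t → ⟪f t, g t⟫ ≤ -c * ‖f t‖ ^ 2) {t : ℝ} (ht : 0 ≤ t) :
    ‖f t‖ ≤ Real.exp (-c * t) * ‖f 0‖ := by
  have hgi : ∀ t, 0 ≤ t → IntervalIntegrable g volume 0 t := fun t ht => by
    refine ContinuousOn.intervalIntegrable (hg.mono ?_)
    rw [uIcc_of_le ht]
    exact Icc_subset_Ici_self
  have hfd : ∀ t, 0 < t → HasDerivAt f (g t) t := by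
    intro t ht
    have h1 : HasDerivAt (fun t => f 0 + ∫ s in (0 : ℝ)..t, g s) (g t) t :=
      (intervalIntegral.integral_hasDerivAt_right (hgi t ht.le)
        (hg.stronglyMeasurableAtFilter_nhdsWithin measurableSet_Ici t |>.filter_mono
          (by rw [(mem_interior_iff_mem_nhds.mp (by simpa using ht) : Ici (0 : ℝ) ∈ 𝓝 t)
            |> nhdsWithin_eq_nhds.mpr]))
        (hg.continuousAt (Ici_mem_nhds ht))).const_add _
    refine h1.congr_of_eventuallyEq ?_
    filter_upwards [Ici_mem_nhds ht] with s hs using hfg s hs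
  have hfc : ContinuousOn f (Ici 0) := by
    have h1 : ContinuousOn (fun t => f 0 + ∫ s in (0 : ℝ)..t, g s) (Ici 0) := by
      refine continuousOn_const.add ?_
      intro t ht
      have h2 := intervalIntegral.continuousOn_primitive_interval' (hgi (t + 1) (by
        linarith [mem_Ici.mp ht])) (left_mem_uIcc)
      have h3 := h2 t (by
        rw [uIcc_of_le (by linarith [mem_Ici.mp ht])]; exact ⟨ht, by linarith⟩)
      rw [uIcc_of_le (by linarith [mem_Ici.mp ht])] at h3
      refine h3.mono_of_mem_nhdsWithin ?_
      rw [mem_nhdsWithin]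
      exact ⟨Iio (t + 1), isOpen_Iio, by simp, fun x hx => ⟨hx.2, hx.1.le⟩⟩
    exact h1.congr fun s hs => hfg s hs
  -- The derivative 2e^{2ct}(c‖f‖² + ⟪f,g⟫) is nonpositive for t > 0; continuity includes t = 0.
  have hanti : AntitoneOn (fun t => Real.exp (2 * c * t) * ‖f t‖ ^ 2) (Ici 0) := by
    have hD : ∀ t, 0 < t → HasDerivAt (fun t => Real.exp (2 * c * t) * ‖f t‖ ^ 2)
        (Real.exp (2 * c * t) * (2 * c) * ‖f t‖ ^ 2
          + Real.exp (2 * c * t) * (2 * ⟪f t, g t⟫)) t := by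
      intro t ht
      have h1 : HasDerivAt (fun t => Real.exp (2 * c * t)) (Real.exp (2 * c * t) * (2 * c)) t := by
        have := ((hasDerivAt_id t).const_mul (2 * c)).exp
        simpa using this
      exact h1.mul (hfd t ht).norm_sq
    refine antitoneOn_of_deriv_nonpos (convex_Ici 0) ?_ ?_ ?_
    · exact (Continuous.continuousOn (by fun_prop)).mul (hfc.norm.pow 2)
    · intro t ht
      rw [interior_Ici] at ht
      exact (hD t ht).differentiableAt.differentiableWithinAt
    · intro t ht
      rw [interior_Ici] at ht
      rw [(hD t ht).deriv]
      have := hd t (le_of_lt ht)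
      have he := Real.exp_pos (2 * c * t)
      nlinarith
  have h1 := hanti (mem_Ici.mpr le_rfl) (mem_Ici.mpr ht) ht
  simp only [mul_zero, Real.exp_zero, one_mul] at h1
  have h2 : ‖f t‖ ^ 2 ≤ (Real.exp (-c * t) * ‖f 0‖) ^ 2 := by
    have h3 := mul_le_mul_of_nonneg_left h1 (Real.exp_pos (-(2 * c * t))).le
    rw [← mul_assoc, ← Real.exp_add, neg_add_cancel, Real.exp_zero, one_mul] at h3
    rw [mul_pow, ← Real.exp_nat_mul]
    convert! h3 using 3
    push_cast
    ring
  exact (pow_le_pow_iff_left₀ (norm_nonneg _) (by positivity) two_ne_zero).mp h2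

section Decay

variable {ε lam c : ℝ} {N : ℕ} {u : ℝ → StripL2}

/-- Decay of a localized mode whose test functions are eigenfunctions of the adjoint problem. -/
lemma IsClosedLoopSolution.norm_mulOp_le (h : IsClosedLoopSolution ε lam c N u) {θ : ℝ → ℝ}
    (hθ : ContDiff ℝ ∞ θ) (hc : HasCompactSupport θ) {χ : ℝ → ℝ} (hχ : ContDiff ℝ ∞ χ)
    (h0 : χ 0 = 0) (h1 : χ 1 = 0) {μ : ℝ}
    (hgen : ∀ (ψ : 𝓢(ℝ, ℂ)) (v : StripL2),
      (∫ x, slice (transversal ε lam χ)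
            (memLp_of_continuous (continuous_transversal ε lam hχ)) v x
              * reFourier (localize hθ hc ψ) x)
        - ε * deriv χ 1 * ∫ x, truncatedFeedback ε lam c N v x * reFourier (localize hθ hc ψ) x
        = μ * ∫ x, slice χ (memLp_of_continuous hχ.continuous) v x
              * reFourier (localize hθ hc ψ) x)
    (hdiss : ∀ k, θ k ≠ 0 → μ - 4 * Real.pi ^ 2 * ε * k ^ 2 ≤ -c) {t : ℝ} (ht : 0 ≤ t) :
    ‖mulOp hθ.continuous hc (freq (slice χ (memLp_of_continuous hχ.continuous) (u t)))‖
      ≤ Real.exp (-c * t) *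
        ‖mulOp hθ.continuous hc (freq (slice χ (memLp_of_continuous hχ.continuous) (u 0)))‖ := by
  set W : StripL2 →L[ℝ] FreqL2 := freq ∘L slice χ (memLp_of_continuous hχ.continuous) with hW
  have hm := contDiff_localSymbol (ε := ε) (μ := μ) hθ
  have hmc := hasCompactSupport_localSymbol (ε := ε) (μ := μ) hc
  set G : StripL2 →L[ℝ] FreqL2 := mulOp hm.continuous hmc ∘L W with hG
  have hgcont : ContinuousOn (fun s => G (u s)) (Ici 0) :=
    G.continuous.comp_continuousOn h.continuous
  refine norm_le_exp_of_integral_eq (f := fun t => mulOp hθ.continuous hc (W (u t)))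
    (g := fun s => G (u s)) hgcont (fun t ht => ?_) (fun t _ => ?_) ht
  · have hgi : IntervalIntegrable (fun s => G (u s)) volume 0 t := by
      refine ContinuousOn.intervalIntegrable (hgcont.mono ?_)
      rw [uIcc_of_le ht]
      exact Icc_subset_Ici_self
    have hweak : ∀ ψ : 𝓢(ℝ, ℂ), ⟪ψ.toLp 2, mulOp hθ.continuous hc (W (u t))⟫
        = ⟪ψ.toLp 2, mulOp hθ.continuous hc (W (u 0)) + ∫ s in (0 : ℝ)..t, G (u s)⟫ := by
      intro ψ
      have hcomm := ContinuousLinearMap.intervalIntegral_comp_comm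
        (innerSL ℝ (ψ.toLp 2 : FreqL2)) hgi
      simp only [innerSL_apply_apply] at hcomm
      rw [inner_add_right, ← hcomm]
      simp only [hG, hW, ContinuousLinearMap.comp_apply]
      rw [inner_mulOp_freq hθ hc, inner_mulOp_freq hθ hc,
        h.weak_schwartz (reFourier (localize hθ hc ψ)) hχ h0 h1 ht]
      congr 2
      ext s
      rw [generator_apply, inner_mulOp_freq hm hmc, add_sub_assoc, hgen ψ (u s),
        ← integral_const_mul, ← integral_const_mul, ← integral_add]
      · congr 1
        ext x
        rw [reFourier_localSymbol hθ hc]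
        ring
      · exact ((Lp.memLp (slice χ (memLp_of_continuous hχ.continuous) (u s))).integrable_mul
          ((secondDeriv (reFourier (localize hθ hc ψ))).memLp 2 (volume : Measure ℝ))).const_mul ε
      · exact ((Lp.memLp (slice χ (memLp_of_continuous hχ.continuous) (u s))).integrable_mul
          ((reFourier (localize hθ hc ψ)).memLp 2 (volume : Measure ℝ))).const_mul μ
    -- The two sides have equal pairings with every Schwartz function. By density their difference
    -- is orthogonal to itself.
    have hdense := SchwartzMap.denseRange_toLpCLM (E := ℝ) (F := ℂ) (p := 2)
      (μ := (volume : Measure ℝ)) (by norm_num)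
    rw [← sub_eq_zero, ← inner_self_eq_zero (𝕜 := ℝ)]
    set e := mulOp hθ.continuous hc (W (u t))
      - (mulOp hθ.continuous hc (W (u 0)) + ∫ s in (0 : ℝ)..t, G (u s))
    refine hdense.induction_on (p := fun z => ⟪z, e⟫ = 0) e
      (isClosed_eq (by fun_prop) continuous_const) fun ψ => ?_
    rw [SchwartzMap.toLpCLM_apply, inner_sub_right, hweak ψ, sub_self]
  -- Dissipativity holds pointwise in k: the integrands are (μ - 4π²εk²)θ²|W|² and -cθ²|W|², so only
  -- frequencies with θ ≠ 0 matter.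
  · rw [← real_inner_self_eq_norm_sq, L2.inner_def, L2.inner_def, ← integral_const_mul]
    refine integral_mono_ae (L2.integrable_inner _ _) ((L2.integrable_inner _ _).const_mul _) ?_
    filter_upwards [coeFn_mulOp hθ.continuous hc (W (u t)),
      coeFn_mulOp hm.continuous hmc (W (u t))] with k e1 e2
    simp only [hG, ContinuousLinearMap.comp_apply]
    rw [e1, e2, inner_smul_left, inner_smul_left, inner_smul_right, inner_smul_right,
      real_inner_self_eq_norm_sq, localSymbol]
    simp only [conj_trivial]
    by_cases hk : θ k = 0
    · simp [hk]
    · have h3 := hdiss k hk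
      have h4 : 0 ≤ θ k ^ 2 * ‖W (u t) k‖ ^ 2 := by positivity
      nlinarith

end Decay

/-! ### Decay of the low and of the high frequencies -/

/-- All three terms integrate the same function of y against different profiles. An identity on
[0,1] therefore suffices, which matters because the gain agrees with the kernel trace only there. -/
lemma integral_slice_add_eq {ψ₁ ψ₂ ψ₃ : ℝ → ℝ} (h₁ : MemLp ψ₁ 2 unitMeasure)
    (h₂ : MemLp ψ₂ 2 unitMeasure) (h₃ : MemLp ψ₃ 2 unitMeasure) {k μ : ℝ}
    (h : ∀ y ∈ Icc (0 : ℝ) 1, ψ₁ y + k * ψ₂ y = μ * ψ₃ y) (v : StripL2) {a : ℝ → ℝ}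
    (ha : MemLp a 2 volume) :
    (∫ x, slice ψ₁ h₁ v x * a x) + k * ∫ x, slice ψ₂ h₂ v x * a x
      = μ * ∫ x, slice ψ₃ h₃ v x * a x := by
  have hr := memLp_slice_fst v ha.toLp
  have i₁ : Integrable (fun y => (∫ x, v (x, y) * ha.toLp a x) * ψ₁ y) unitMeasure :=
    hr.integrable_mul h₁
  have i₂ : Integrable (fun y => (∫ x, v (x, y) * ha.toLp a x) * ψ₂ y) unitMeasure :=
    hr.integrable_mul h₂
  rw [← inner_toLp ha, ← inner_toLp ha, ← inner_toLp ha, inner_slice', inner_slice', inner_slice',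
    ← integral_const_mul, ← integral_const_mul, ← integral_add i₁ (i₂.const_mul k)]
  refine integral_congr_ae ?_
  filter_upwards [ae_restrict_mem measurableSet_Icc] with y hy
  linear_combination (∫ x, v (x, y) * ha.toLp a x) * h y hy

lemma contDiff_sineMode (n : ℕ) : ContDiff ℝ ∞ (sineMode n) := by
  unfold sineMode; fun_prop

lemma deriv_deriv_sineMode (n : ℕ) (y : ℝ) :
    deriv (deriv (sineMode n)) y = -(((n + 1) * Real.pi) ^ 2) * sineMode n y := by
  rw [show deriv (sineMode n) = sineModeDeriv n from funext fun y => (hasDerivAt_sineMode n y).deriv]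
  exact (hasDerivAt_sineModeDeriv n y).deriv

lemma contDiff_backMode (L : ℝ) (n : ℕ) : ContDiff ℝ ∞ (backMode L n) :=
  contDiff_adjointTransform (hasDerivAt_sineMode n) (hasDerivAt_sineModeDeriv n) (sineMode_one n)

/-- Since b_n'(1) = s_n'(1), the gain cancels the source k(1,·), and ελ₀ = λ + c replaces λ by -c.
-/
lemma transversal_backMode {ε lam c : ℝ} (hε : 0 < ε) (hcl : 0 ≤ c + lam) (n : ℕ) {y : ℝ}
    (hy : y ∈ Icc (0 : ℝ) 1) :
    transversal ε lam (backMode (lambda0 ε lam c) n) y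
        + ε * deriv (backMode (lambda0 ε lam c) n) 1 * gain ε lam c y
      = -(c + ε * ((n + 1) * Real.pi) ^ 2) * backMode (lambda0 ε lam c) n y := by
  have hL : 0 ≤ lambda0 ε lam c := div_nonneg (by linarith) hε.le
  have hL' : ε * lambda0 ε lam c = lam + c := mul_div_cancel₀ _ hε.ne'
  have h2 := (hasDerivAt_deriv_adjointTransform (L := lambda0 ε lam c) (hasDerivAt_sineMode n)
    (hasDerivAt_sineModeDeriv n) (sineMode_one n) y).deriv
  have h1 := deriv_adjointTransform_one (L := lambda0 ε lam c) (hasDerivAt_sineMode n)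
    (sineMode_one n)
  rw [gain_eq_backKernel hL hy, transversal, backMode, h1, h2]
  linear_combination (-adjointTransform (lambda0 ε lam c) (sineMode n) y) * hL'

section Modes

variable {ε lam c : ℝ} {N : ℕ} {u : ℝ → StripL2}

/-- Inside the band the filter reproduces the test function, so the truncated law acts as the full
backstepping law. No lower bound on N enters. -/
lemma IsClosedLoopSolution.norm_mulOp_backMode_le (h : IsClosedLoopSolution ε lam c N u)
    (hε : 0 < ε) (hcl : 0 ≤ c + lam) {θ : ℝ → ℝ} (hθ : ContDiff ℝ ∞ θ) (hc : HasCompactSupport θ)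
    (hθN : ∀ k, (N : ℝ) ≤ |k| → θ k = 0) (n : ℕ) {t : ℝ} (ht : 0 ≤ t) :
    ‖mulOp hθ.continuous hc (freq (slice _ (memLp_backMode (lambda0 ε lam c) n) (u t)))‖
      ≤ Real.exp (-c * t) *
        ‖mulOp hθ.continuous hc (freq (slice _ (memLp_backMode (lambda0 ε lam c) n) (u 0)))‖ := by
  refine h.norm_mulOp_le (μ := -(c + ε * ((n + 1) * Real.pi) ^ 2)) hθ hc
    (contDiff_backMode (lambda0 ε lam c) n) (adjointTransform_zero (sineMode_zero n))
    (adjointTransform_one (sineMode_one n)) (fun ψ v => ?_) (fun k _ => ?_) ht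
  · have hb : ∀ k : ℝ, (N : ℝ) ≤ |k| → localize hθ hc ψ k = 0 := fun k hk => by
      rw [localize_apply, hθN k hk, zero_smul]
    rw [integral_truncatedFeedback_mul,
      funext fun ξ => congrArg (_ * ·) (integral_reFourier_mul_lowPass_of_low hb ξ), mul_neg,
      sub_neg_eq_add]
    exact integral_slice_add_eq _ _ _ (fun y hy => transversal_backMode hε hcl n hy) v
      ((reFourier (localize hθ hc ψ)).memLp 2)
  · have : 0 ≤ ε * ((n + 1) * Real.pi) ^ 2 + 4 * Real.pi ^ 2 * ε * k ^ 2 := by positivity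
    linarith

/-- Outside the band the filter annihilates the test function and plain Dirichlet modes remain. The
bound on N makes longitudinal diffusion alone outweigh c + λ. -/
lemma IsClosedLoopSolution.norm_mulOp_sineMode_le (h : IsClosedLoopSolution ε lam c N u)
    (hε : 0 < ε) (hN : Real.sqrt ((c + lam) / (4 * Real.pi ^ 2 * ε)) ≤ N) {θ : ℝ → ℝ}
    (hθ : ContDiff ℝ ∞ θ) (hc : HasCompactSupport θ)
    (hθN : ∀ k, |k| ≤ (N : ℝ) → θ k = 0) (n : ℕ) {t : ℝ} (ht : 0 ≤ t) :
    ‖mulOp hθ.continuous hc (freq (slice _ (memLp_sineMode n) (u t)))‖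
      ≤ Real.exp (-c * t) *
        ‖mulOp hθ.continuous hc (freq (slice _ (memLp_sineMode n) (u 0)))‖ := by
  refine h.norm_mulOp_le (μ := lam - ε * ((n + 1) * Real.pi) ^ 2) hθ hc
    (contDiff_sineMode n) (sineMode_zero n) (sineMode_one n) (fun ψ v => ?_) (fun k hk => ?_) ht
  · have hb : ∀ k : ℝ, |k| ≤ (N : ℝ) → localize hθ hc ψ k = 0 := fun k hk => by
      rw [localize_apply, hθN k hk, zero_smul]
    rw [integral_truncatedFeedback_mul,
      funext fun ξ => congrArg (_ * ·) (integral_reFourier_mul_lowPass_of_high hb ξ)]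
    -- With k = 0 the second profile is a dummy: there is no feedback term.
    have h3 := integral_slice_add_eq (k := 0) (μ := lam - ε * ((n + 1) * Real.pi) ^ 2)
      (memLp_of_continuous (continuous_transversal ε lam (contDiff_sineMode n)))
      (memLp_sineMode n) (memLp_sineMode n) (fun y _ => by
        rw [transversal, deriv_deriv_sineMode]; ring) v
      ((reFourier (localize hθ hc ψ)).memLp 2 (volume : Measure ℝ))
    simpa using h3
  · have hNk : (N : ℝ) < |k| := by
      by_contra! hle
      exact hk (hθN k hle)
    have h1 : (c + lam) / (4 * Real.pi ^ 2 * ε) ≤ k ^ 2 := by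
      rw [← sq_abs k]
      exact (Real.sqrt_le_left (abs_nonneg k)).mp (hN.trans hNk.le)
    rw [div_le_iff₀ (by positivity)] at h1
    have : 0 ≤ ε * ((n + 1) * Real.pi) ^ 2 := by positivity
    linarith

end Modes

/-! ### Smooth frequency cutoffs -/

/-- Smooth compactly supported functions that increase to the indicator of `{q > 0}`. -/
def cutoff (q : ℝ → ℝ) (j : ℕ) (k : ℝ) : ℝ :=
  Real.smoothTransition (j * q k) * Real.smoothTransition (j - k ^ 2)

section Cutoff

variable {q : ℝ → ℝ}

lemma contDiff_cutoff (hq : ContDiff ℝ ∞ q) (j : ℕ) : ContDiff ℝ ∞ (cutoff q j) :=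
  (Real.smoothTransition.contDiff.comp (by fun_prop)).mul
    (Real.smoothTransition.contDiff.comp (by fun_prop))

lemma hasCompactSupport_cutoff (q : ℝ → ℝ) (j : ℕ) : HasCompactSupport (cutoff q j) := by
  refine HasCompactSupport.intro (K := Icc (-(j + 1 : ℝ)) (j + 1)) isCompact_Icc fun k hk => ?_
  have hk : (j + 1 : ℝ) < |k| := by
    by_contra! hle
    exact hk (abs_le.mp hle)
  rw [cutoff, Real.smoothTransition.zero_of_nonpos (x := j - k ^ 2), mul_zero]
  rw [← sq_abs]
  nlinarith [Nat.cast_nonneg (α := ℝ) j]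

lemma cutoff_eq_zero {k : ℝ} (hk : q k ≤ 0) (j : ℕ) : cutoff q j k = 0 := by
  rw [cutoff, Real.smoothTransition.zero_of_nonpos
    (mul_nonpos_of_nonneg_of_nonpos (Nat.cast_nonneg j) hk), zero_mul]

lemma abs_cutoff_le (q : ℝ → ℝ) (j : ℕ) (k : ℝ) : |cutoff q j k| ≤ 1 := by
  rw [cutoff, abs_of_nonneg
    (mul_nonneg (Real.smoothTransition.nonneg _) (Real.smoothTransition.nonneg _))]
  exact mul_le_one₀ (Real.smoothTransition.le_one _) (Real.smoothTransition.nonneg _)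
    (Real.smoothTransition.le_one _)

lemma eventually_cutoff_eq_one {k : ℝ} (hk : 0 < q k) : ∀ᶠ j in atTop, cutoff q j k = 1 := by
  have hj := tendsto_natCast_atTop_atTop (R := ℝ)
  filter_upwards [hj.eventually_ge_atTop (1 / q k), hj.eventually_ge_atTop (k ^ 2 + 1)]
    with j h1 h2
  rw [cutoff, Real.smoothTransition.one_of_one_le ((div_le_iff₀ hk).mp h1),
    Real.smoothTransition.one_of_one_le (by linarith), mul_one]

end Cutoff

lemma enorm_mulOp_sq {θ : ℝ → ℝ} (hθ : Continuous θ) (hc : HasCompactSupport θ) (f : FreqL2) :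
    ‖mulOp hθ hc f‖ₑ ^ 2 = ∫⁻ k, ‖θ k‖ₑ ^ 2 * ‖f k‖ₑ ^ 2 := by
  rw [enorm_Lp_sq]
  refine lintegral_congr_ae ?_
  filter_upwards [coeFn_mulOp hθ hc f] with k hk
  rw [hk, enorm_smul, mul_pow]

lemma enorm_mulOp_sq_le {θ : ℝ → ℝ} (hθ : Continuous θ) (hc : HasCompactSupport θ)
    (h1 : ∀ k, |θ k| ≤ 1) (f : FreqL2) : ‖mulOp hθ hc f‖ₑ ^ 2 ≤ ‖f‖ₑ ^ 2 := by
  rw [enorm_mulOp_sq, enorm_Lp_sq f]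
  refine lintegral_mono fun k => mul_le_of_le_one_left' (pow_le_one₀ zero_le ?_)
  rw [← ofReal_norm, ENNReal.ofReal_le_one]
  exact h1 k

/-- Two complementary families of cutoffs recover the full norms in the limit. -/
lemma tsum_enorm_sq_le_of_cutoff {q : ℝ → ℝ} (hq : ContDiff ℝ ∞ q) (h0 : ∀ᵐ k, q k ≠ 0)
    (f : ℕ → FreqL2) {B : ℝ≥0∞}
    (hB : ∀ j,
      ∑' n, ‖mulOp (contDiff_cutoff hq j).continuous (hasCompactSupport_cutoff q j) (f n)‖ₑ ^ 2
      + ∑' n, ‖mulOp (contDiff_cutoff (q := -q) hq.neg j).continuous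
          (hasCompactSupport_cutoff (-q) j) (f n)‖ₑ ^ 2 ≤ B) :
    ∑' n, ‖f n‖ₑ ^ 2 ≤ B := by
  have hf : ∀ n, AEMeasurable (fun k => ‖f n k‖ₑ ^ 2) volume := fun n =>
    (Lp.aestronglyMeasurable (f n)).enorm.pow_const 2
  set w : ℕ → ℝ → ℝ≥0∞ := fun j k => ‖cutoff q j k‖ₑ ^ 2 + ‖cutoff (-q) j k‖ₑ ^ 2 with hw
  have hm : ∀ {q : ℝ → ℝ} (_ : ContDiff ℝ ∞ q) j, AEMeasurable (fun k => ‖cutoff q j k‖ₑ ^ 2)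
      (volume : Measure ℝ) := fun hq j => by
    have := (contDiff_cutoff hq j).continuous
    fun_prop
  have hwm : ∀ j, AEMeasurable (w j) volume := fun j => (hm hq j).add (hm (q := -q) hq.neg j)
  have hS : AEMeasurable (fun k => ∑' n, ‖f n k‖ₑ ^ 2) volume := AEMeasurable.tsum hf
  calc ∑' n, ‖f n‖ₑ ^ 2 = ∫⁻ k, ∑' n, ‖f n k‖ₑ ^ 2 := by
        rw [lintegral_tsum hf]
        simp only [enorm_Lp_sq]
    -- At almost every k one of the two cutoffs is eventually 1, so the weight is eventually at
    -- least 1. Fatou's lemma then carries the bound, uniform in j, to the limit.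
    _ ≤ ∫⁻ k, liminf (fun j => w j k * ∑' n, ‖f n k‖ₑ ^ 2) atTop := by
        refine lintegral_mono_ae ?_
        filter_upwards [h0] with k hk
        refine le_liminf_of_le (by isBoundedDefault) ?_
        rcases lt_or_gt_of_ne hk with hk | hk
        · filter_upwards [eventually_cutoff_eq_one (q := -q) (by simpa using hk : 0 < (-q) k)]
            with j hj
          refine le_mul_of_one_le_left' ?_
          simp [hw, hj]
        · filter_upwards [eventually_cutoff_eq_one hk] with j hj
          refine le_mul_of_one_le_left' ?_
          simp [hw, hj]
    _ ≤ liminf (fun j => ∫⁻ k, w j k * ∑' n, ‖f n k‖ₑ ^ 2) atTop :=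
        lintegral_liminf_le' fun j => (hwm j).mul hS
    _ ≤ B := by
        refine liminf_le_of_frequently_le' (Frequently.of_forall fun j => ?_)
        refine le_trans (le_of_eq ?_) (hB j)
        simp only [hw, add_mul, ← ENNReal.tsum_mul_left, enorm_mulOp_sq]
        have hl : ∀ n, AEMeasurable (fun k => ‖cutoff q j k‖ₑ ^ 2 * ‖f n k‖ₑ ^ 2) volume :=
          fun n => (hm hq j).mul (hf n)
        have hh : ∀ n, AEMeasurable (fun k => ‖cutoff (-q) j k‖ₑ ^ 2 * ‖f n k‖ₑ ^ 2) volume :=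
          fun n => (hm (q := -q) hq.neg j).mul (hf n)
        rw [lintegral_add_left' (AEMeasurable.tsum hl), lintegral_tsum hl, lintegral_tsum hh]

lemma enorm_sq_le_of_norm_le {E F : Type*} [NormedAddCommGroup E] [NormedAddCommGroup F] {a : E}
    {b : F} {r : ℝ} (hr : 0 ≤ r) (h : ‖a‖ ≤ r * ‖b‖) :
    ‖a‖ₑ ^ 2 ≤ ENNReal.ofReal r ^ 2 * ‖b‖ₑ ^ 2 := by
  rw [← mul_pow, ← ofReal_norm, ← ofReal_norm, ← ENNReal.ofReal_mul hr]
  gcongr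

/-- The decay estimate with a constant from the equivalence of the two families of modes. -/
lemma IsClosedLoopSolution.norm_le {ε lam c : ℝ} {N : ℕ} {u : ℝ → StripL2}
    (h : IsClosedLoopSolution ε lam c N u) (hε : 0 < ε) (hcl : 0 ≤ c + lam)
    (hN : Real.sqrt ((c + lam) / (4 * Real.pi ^ 2 * ε)) ≤ N) {C : ℝ≥0}
    (hC : ∀ r : ℝ → ℝ, MemLp r 2 unitMeasure →
      ∑' n, ‖∫ y, r y * backMode (lambda0 ε lam c) n y ∂unitMeasure‖ₑ ^ 2
        ≤ C * ∑' n, ‖∫ y, r y * sineMode n y ∂unitMeasure‖ₑ ^ 2 ∧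
      ∑' n, ‖∫ y, r y * sineMode n y ∂unitMeasure‖ₑ ^ 2
        ≤ C * ∑' n, ‖∫ y, r y * backMode (lambda0 ε lam c) n y ∂unitMeasure‖ₑ ^ 2) {t : ℝ}
    (ht : 0 ≤ t) :
    ‖u t‖ ≤ Real.sqrt (C ^ 2 + 1) * Real.exp (-c * t) * ‖u 0‖ := by
  set L := lambda0 ε lam c
  set e : ℝ≥0∞ := ENNReal.ofReal (Real.exp (-c * t)) with he
  set S : ℝ≥0∞ := ∑' n, ‖slice (sineMode n) (memLp_sineMode n) (u 0)‖ₑ ^ 2 with hS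
  -- The sign of q separates |k| < N from |k| > N, and its zeros ±N form a null set.
  set q : ℝ → ℝ := fun k => (N : ℝ) ^ 2 - k ^ 2 with hq
  have hqs : ContDiff ℝ ∞ q := by fun_prop
  have hq0 : ∀ᵐ k : ℝ, q k ≠ 0 := by
    have hfin : ({(N : ℝ), -(N : ℝ)} : Set ℝ).Finite := by simp
    filter_upwards [compl_mem_ae_iff.mpr (hfin.measure_zero volume)] with k hk hk0
    exact hk (sq_eq_sq_iff_eq_or_eq_neg.mp (sub_eq_zero.mp hk0).symm)
  have key : ∑' n, ‖freq (slice (sineMode n) (memLp_sineMode n) (u t))‖ₑ ^ 2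
      ≤ (C ^ 2 + 1) * e ^ 2 * S := by
    refine tsum_enorm_sq_le_of_cutoff hqs hq0 _ fun j => ?_
    -- One factor C passes from sine to backstepping coefficients at time t, where decay is known;
    -- the other returns to sine coefficients at time 0.
    have hlow : ∑' n, ‖mulOp (contDiff_cutoff hqs j).continuous (hasCompactSupport_cutoff q j)
        (freq (slice (sineMode n) (memLp_sineMode n) (u t)))‖ₑ ^ 2 ≤ C * (e ^ 2 * (C * S)) := by
      refine (tsum_enorm_sq_slice_le (mulOp (contDiff_cutoff hqs j).continuous
        (hasCompactSupport_cutoff q j) ∘L freq) memLp_sineMode (memLp_backMode L)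
        (fun r hr => (hC r hr).2) (u t)).trans ?_
      gcongr
      calc _ ≤ ∑' n, e ^ 2 * ‖slice (backMode L n) (memLp_backMode L n) (u 0)‖ₑ ^ 2 := by
            refine ENNReal.tsum_le_tsum fun n => ?_
            refine (enorm_sq_le_of_norm_le (Real.exp_pos _).le (h.norm_mulOp_backMode_le hε hcl
              (contDiff_cutoff hqs j) (hasCompactSupport_cutoff q j)
              (fun k hk => cutoff_eq_zero ?_ j) n ht)).trans ?_
            · simp only [hq]
              nlinarith [sq_abs k, Nat.cast_nonneg (α := ℝ) N]
            · rw [← enorm_freq_sq]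
              exact mul_le_mul' le_rfl (enorm_mulOp_sq_le _ _ (abs_cutoff_le q j) _)
        _ = e ^ 2 * ∑' n, ‖slice (backMode L n) (memLp_backMode L n) (u 0)‖ₑ ^ 2 :=
            ENNReal.tsum_mul_left
        _ ≤ e ^ 2 * (C * S) := by
            gcongr
            exact tsum_enorm_sq_slice_le (ContinuousLinearMap.id ℝ LineL2) (memLp_backMode L)
              memLp_sineMode (fun r hr => (hC r hr).1) (u 0)
    have hhigh : ∑' n, ‖mulOp (contDiff_cutoff (q := -q) hqs.neg j).continuous
        (hasCompactSupport_cutoff (-q) j)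
        (freq (slice (sineMode n) (memLp_sineMode n) (u t)))‖ₑ ^ 2 ≤ e ^ 2 * S := by
      rw [hS, ← ENNReal.tsum_mul_left]
      refine ENNReal.tsum_le_tsum fun n => ?_
      refine (enorm_sq_le_of_norm_le (Real.exp_pos _).le (h.norm_mulOp_sineMode_le hε hN
        (contDiff_cutoff (q := -q) hqs.neg j) (hasCompactSupport_cutoff (-q) j)
        (fun k hk => cutoff_eq_zero ?_ j) n ht)).trans ?_
      · simp only [hq, Pi.neg_apply]
        nlinarith [sq_abs k, abs_nonneg k]
      · rw [← enorm_freq_sq (slice (sineMode n) (memLp_sineMode n) (u 0))]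
        exact mul_le_mul' le_rfl (enorm_mulOp_sq_le _ _ (abs_cutoff_le (-q) j) _)
    refine (add_le_add hlow hhigh).trans (le_of_eq ?_)
    ring
  simp only [enorm_freq_sq] at key
  have h2 : ‖u t‖ₑ ^ 2 ≤ (C ^ 2 + 1) * e ^ 2 * ‖u 0‖ₑ ^ 2 := by
    rw [← two_mul_tsum_enorm_sq_slice_sineMode, ← two_mul_tsum_enorm_sq_slice_sineMode]
    calc _ ≤ 2 * ((C ^ 2 + 1) * e ^ 2 * S) := by gcongr
      _ = _ := by ring
  have h3 := ENNReal.toReal_mono (by finiteness) h2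
  simp only [ENNReal.toReal_mul, ENNReal.toReal_pow, toReal_enorm, he,
    ENNReal.toReal_ofReal (Real.exp_pos _).le] at h3
  rw [ENNReal.toReal_add (by finiteness) (by finiteness)] at h3
  simp only [ENNReal.toReal_pow, ENNReal.coe_toReal, ENNReal.toReal_one] at h3
  refine (pow_le_pow_iff_left₀ (norm_nonneg _) (by positivity) two_ne_zero).mp (h3.trans_eq ?_)
  rw [mul_pow, mul_pow, Real.sq_sqrt (by positivity)]

end StripControl

end

/-- Exponential stability in `L²(ℝ × [0, 1])`, with rate `c` and an overshoot constant `M` that is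
the same for all truncation levels `N ≥ √((c + λ) / (4 π² ε))` and all solutions. -/
theorem theorem1 (ε lam c : ℝ) (hε : 0 < ε) (hc : 0 < c) (hcl : 0 ≤ c + lam) :
    ∃ M : ℝ, 1 ≤ M ∧
      ∀ N : ℕ, Real.sqrt ((c + lam) / (4 * Real.pi ^ 2 * ε)) ≤ (N : ℝ) →
        ∀ u : ℝ → StripControl.StripL2, StripControl.IsClosedLoopSolution ε lam c N u →
          ∀ t : ℝ, 0 ≤ t → ‖u t‖ ≤ M * Real.exp (-c * t) * ‖u 0‖ := by
  obtain ⟨C, hC⟩ := StripControl.exists_backMode_bounds (StripControl.lambda0 ε lam c)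
  -- C is fixed by λ₀ before N and u are introduced, which gives the uniformity.
  refine ⟨Real.sqrt (C ^ 2 + 1), ?_, fun N hN u hu t ht => hu.norm_le hε hcl hN hC ht⟩
  rw [Real.one_le_sqrt]
  nlinarith [sq_nonneg (C : ℝ)]
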